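/- Proposition. Let $\mathbb K$ be $\mathbb R$ or $\mathbb C$; all Banach spaces are over $\mathbb K$ and all operators are bounded and linear. **Trees.** Finite sequences are ordered by initial segments; $\mathrm{MAX}(T)$ is the set of maximal members of a set $T$ of non-empty finite sequences, $\frown$ is concatenation, and $\zeta+(\zeta_i)_{i=1}^k=(\zeta+\zeta_i)_{i=1}^k$ for ordinals. For every ordinal $\xi$ and $n\in\mathbb N=\{1,2,\dots\}$ define a set $\Gamma_{\xi,n}$ of finite sequences of ordinals and $\mathbb P_{\xi,n}:\Gamma_{\xi,n}\to[0,1]$ recursively by - $\Gamma_{0,1}=\{(0)\}$, $\mathbb P_{0,1}((0))=1$; - $\Gamma_{\xi,n+1}=\{\omega^\xi n+s: s\in\Gamma_{\xi,1}\}\cup\{(\omega^\xi n+t)\frown u: t\in \mathrm{MAX}(\Gamma_{\xi,1}),\,u\in\Gamma_{\xi,n}\}$, $\mathbb P_{\xi,n+1}(\omega^\xi n+s)=\mathbb P_{\xi,1}(s)$, $\mathbb P_{\xi,n+1}((\omega^\xi n+t)\frown u)=\mathbb P_{\xi,n}(u)$; - $\Gamma_{\xi+1,1}=\bigcup_{n\ge1}\Gamma_{\xi,n}$,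 $\mathbb P_{\xi+1,1}|_{\Gamma_{\xi,n}}=n^{-1}\mathbb P_{\xi,n}$; - for limit $\xi$, $\Gamma_{\xi,1}=\bigcup_{\zeta<\xi}(\omega^\zeta+\Gamma_{\zeta+1,1})$, $\mathbb P_{\xi,1}(\omega^\zeta+t)=\mathbb P_{\zeta+1,1}(t)$ (all these unions are disjoint). For $1\le i\le n$ the level $\Lambda_{\xi,n,i}$ is the set of all $(\omega^\xi(n-1)+t_1)\frown\dots\frown(\omega^\xi(n-i)+t_i)$ with $t_i\in\Gamma_{\xi,1}$ and $t_j\in\mathrm{MAX}(\Gamma_{\xi,1})$ for $j<i$. **Weakly null collections.** For a Banach space $X$ let $D_X$ be the set of weakly open sets containing $0$, directed by reverse inclusion. Let $\Gamma_{\xi,n}.D_X$ be the set of all sequences $(\zeta_i,u_i)_{i=1}^k$ with $(\zeta_i)_{i=1}^k\in\Gamma_{\xi,n}$ and $u_i\in D_X$; levels and $\mathbb P_{\xi,n}$ are carried over to it by forgetting the $u_i$. Let $\mathcal B^X_{\xi,n}$ be the set of all collections $(x_t)_{t\in\Gamma_{\xi,n}.D_X}$ in the closed unit ball of $X$ such that,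 for all $t\in\{\varnothing\}\cup\Gamma_{\xi,n}.D_X$ and all $\zeta$ for which the sequences $t\frown(\zeta,u)$, $u\in D_X$, belong to $\Gamma_{\xi,n}.D_X$, the net $(x_{t\frown(\zeta,u)})_{u\in D_X}$ is weakly null. **The quantities $\theta_{\xi,n}$.** For an operator $A:X\to Y$ between Banach spaces and a finitely supported scalar sequence $(a_i)_{i\ge1}$ let $$\Bigl\|\sum_i a_ie_i\Bigr\|_{\xi,A}=\sup\Bigl\{\inf_{t\in \mathrm{MAX}(\Gamma_{\xi,n}.D_X)}\Bigl\|A\sum_{i=1}^n a_i\sum_{\Lambda_{\xi,n,i}.D_X\ni s\le t}\mathbb P_{\xi,n}(s)x_s\Bigr\| : n\in\mathbb N,\ (x_t)\in\mathcal B^X_{\xi,n}\Bigr\},$$ and $\theta_{\xi,n}(A)=\bigl\|n^{-1}\sum_{i=1}^n e_i\bigr\|_{\xi,A}$. **Claim.** Let $\xi$ be an ordinal, $1<p\le\infty$ and $1/p+1/q=1$. Let $\mathfrak N_{\xi,p}$ be the class of all operators $A$ between Banach spaces with $\sup_{n} n^{1/q}\theta_{\xi,n}(A)<\infty$, and put $\mathfrak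 n_{\xi,p}(A)=\|A\|+\sup_n n^{1/q}\theta_{\xi,n}(A)$. Then $(\mathfrak N_{\xi,p},\mathfrak n_{\xi,p})$ is a Banach ideal, that is, for all Banach spaces $W,X,Y,Z$: 1. $\mathfrak N_{\xi,p}(X,Y)=\mathfrak N_{\xi,p}\cap\mathfrak L(X,Y)$ is a linear subspace of the space $\mathfrak L(X,Y)$ of operators that contains the operators $x^*\otimes y: x\mapsto x^*(x)y$ for $x^*\in X^*$, $y\in Y$; and $BAC\in\mathfrak N_{\xi,p}$ whenever $C\in\mathfrak L(W,X)$, $A\in\mathfrak N_{\xi,p}(X,Y)$, $B\in\mathfrak L(Y,Z)$; 2. $\mathfrak n_{\xi,p}$ is a norm on $\mathfrak N_{\xi,p}(X,Y)$, $\mathfrak n_{\xi,p}(x^*\otimes y)=\|x^*\|\,\|y\|$, and $\mathfrak n_{\xi,p}(BAC)\le\|B\|\,\mathfrak n_{\xi,p}(A)\,\|C\|$ for $A,B,C$ as in 1; 3. $\mathfrak N_{\xi,p}(X,Y)$ is complete with respect to $\mathfrak n_{\xi,p}$. -/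

import Mathlib

open scoped ENNReal Ordinal Topology

universe u v w

noncomputable section

namespace SzlenkIdeal

/-! ### Trees of finite sequences -/

/-- The members of a set of finite sequences that are maximal for the initial segment order. -/
def maxNodes {Λ : Type*} (T : Set (List Λ)) : Set (List Λ) :=
  {t | t ∈ T ∧ ∀ s ∈ T, t <+: s → s = t}

/-- The sequence `ζ + t = (ζ + ζ₁, …, ζ + ζₖ)`. -/
def shift (ζ : Ordinal.{v}) (t : List Ordinal.{v}) : List Ordinal.{v} :=
  t.map fun η => ζ + η

/-- The tree `T.D` of all sequences `(ζᵢ, uᵢ)ᵢ` with `(ζᵢ)ᵢ ∈ T` and `uᵢ ∈ D`. -/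
def treeProd {Λ : Type*} (T : Set (List Λ)) (D : Type*) : Set (List (Λ × D)) :=
  {t | t.map Prod.fst ∈ T}

/-! ### The trees `Γ_{ξ,n}`, their weights `ℙ_{ξ,n}` and their levels

A tree with a weight function is handled through the graph of the weight function, a set of pairs
`(t, r)` where `t` is a member of the tree and `r` is its weight. -/

/-- Given `w = ω ^ ξ` and the graph `G` of `ℙ_{ξ,1}`, the graphs of `ℙ_{ξ,n}` for `n = 0, 1, 2, …`,
where `Γ_{ξ,0}` is empty. For `n = 0` the successor clause returns `G` itself. -/
def stackGraph (w : Ordinal.{v}) (G : Set (List Ordinal.{v} × ℝ)) :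
    ℕ → Set (List Ordinal.{v} × ℝ)
  | 0 => ∅
  | n + 1 =>
      {p | ∃ s r, (s, r) ∈ G ∧ p = (shift (w * n) s, r)} ∪
      {p | ∃ t ∈ maxNodes (Prod.fst '' G), ∃ u r, (u, r) ∈ stackGraph w G n ∧
        p = (shift (w * n) t ++ u, r)}

/-- The graph of `ℙ_{ξ,1} : Γ_{ξ,1} → [0,1]`. -/
def graphOne (ξ : Ordinal.{v}) : Set (List Ordinal.{v} × ℝ) :=
  Ordinal.limitRecOn ξ
    {([0], 1)}
    (fun ζ G => {p | ∃ n : ℕ, 1 ≤ n ∧ ∃ t r, (t, r) ∈ stackGraph (ω ^ ζ) G n ∧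
      p = (t, (n : ℝ)⁻¹ * r)})
    (fun ξ hξ ih => {p | ∃ ζ, ∃ h : ζ < ξ, ∃ t r,
      (t, r) ∈ ih (ζ + 1) (hξ.add_one_lt h) ∧ p = (shift (ω ^ ζ) t, r)})

/-- The graph of `ℙ_{ξ,n} : Γ_{ξ,n} → [0,1]`, for `n ≥ 1`. -/
def graph (ξ : Ordinal.{v}) (n : ℕ) : Set (List Ordinal.{v} × ℝ) :=
  stackGraph (ω ^ ξ) (graphOne ξ) n

/-- The tree `Γ_{ξ,n}`, for `n ≥ 1`. -/
def Gam (ξ : Ordinal.{v}) (n : ℕ) : Set (List Ordinal.{v}) :=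
  Prod.fst '' graph ξ n

open Classical in
/-- The weight `ℙ_{ξ,n}(t)` of a member `t` of `Γ_{ξ,n}`. It is uniquely determined, see
`weight_eq`. -/
def weight (ξ : Ordinal.{v}) (n : ℕ) (t : List Ordinal.{v}) : ℝ :=
  if h : ∃ r, (t, r) ∈ graph ξ n then h.choose else 0

/-- The levels of `Γ_{ξ,n}`, counted from zero: for `i < n`, `level ξ n i` is `Λ_{ξ,n,i+1}`, the
set of all `t = (ω^ξ (n-1) + t₁) ⌢ … ⌢ (ω^ξ (n-i-1) + tᵢ₊₁)` where `tᵢ₊₁ ∈ Γ_{ξ,1}` and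
`t₁, …, tᵢ` are maximal members of `Γ_{ξ,1}`. -/
def level (ξ : Ordinal.{v}) : ℕ → ℕ → Set (List Ordinal.{v})
  | 0, _ => ∅
  | n + 1, 0 => {p | ∃ s ∈ Gam ξ 1, p = shift (ω ^ ξ * n) s}
  | n + 1, i + 1 => {p | ∃ t ∈ maxNodes (Gam ξ 1), ∃ u ∈ level ξ n i,
      p = shift (ω ^ ξ * n) t ++ u}

/-! ### The recursive description of the trees, and uniqueness of the weights -/

theorem shift_zero (t : List Ordinal.{v}) : shift 0 t = t := by
  simp [shift]

theorem shift_injective (ζ : Ordinal.{v}) : Function.Injective (shift ζ) :=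
  List.map_injective_iff.2 fun _ _ h => by simpa using h

theorem graph_one (ξ : Ordinal.{v}) : graph ξ 1 = graphOne ξ := by
  ext ⟨t, r⟩
  simp [graph, stackGraph, shift_zero]

theorem graph_zero_one : graph (0 : Ordinal.{v}) 1 = {([0], 1)} := by
  rw [graph_one, graphOne, Ordinal.limitRecOn_zero]

theorem graph_succ_one (ξ : Ordinal.{v}) :
    graph (ξ + 1) 1 = {p | ∃ n : ℕ, 1 ≤ n ∧ ∃ t r, (t, r) ∈ graph ξ n ∧
      p = (t, (n : ℝ)⁻¹ * r)} := by
  rw [graph_one, graphOne, Ordinal.limitRecOn_add_one]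
  rfl

theorem graph_limit_one (ξ : Ordinal.{v}) (hξ : Order.IsSuccLimit ξ) :
    graph ξ 1 = {p | ∃ ζ < ξ, ∃ t r, (t, r) ∈ graph (ζ + 1) 1 ∧ p = (shift (ω ^ ζ) t, r)} := by
  rw [graph_one, graphOne, Ordinal.limitRecOn_limit _ _ _ _ hξ]
  simp only [graph_one, exists_prop]
  rfl

theorem graph_add_one (ξ : Ordinal.{v}) (n : ℕ) :
    graph ξ (n + 1) = {p | ∃ s r, (s, r) ∈ graph ξ 1 ∧ p = (shift (ω ^ ξ * n) s, r)} ∪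
      {p | ∃ t ∈ maxNodes (Gam ξ 1), ∃ u r, (u, r) ∈ graph ξ n ∧
        p = (shift (ω ^ ξ * n) t ++ u, r)} := by
  simp only [Gam, graph_one]
  rfl

theorem Gam_zero_one : Gam (0 : Ordinal.{v}) 1 = {[0]} := by
  simp [Gam, graph_zero_one]

theorem Gam_succ_one (ξ : Ordinal.{v}) : Gam (ξ + 1) 1 = ⋃ n ≥ 1, Gam ξ n := by
  ext t
  simp [Gam, graph_succ_one]

theorem Gam_limit_one (ξ : Ordinal.{v}) (hξ : Order.IsSuccLimit ξ) :
    Gam ξ 1 = ⋃ ζ < ξ, shift (ω ^ ζ) '' Gam (ζ + 1) 1 := by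
  ext t
  simp only [Gam, graph_limit_one ξ hξ]
  simp
  grind

theorem Gam_add_one (ξ : Ordinal.{v}) (n : ℕ) :
    Gam ξ (n + 1) = {p | ∃ s ∈ Gam ξ 1, p = shift (ω ^ ξ * n) s} ∪
      {p | ∃ t ∈ maxNodes (Gam ξ 1), ∃ u ∈ Gam ξ n, p = shift (ω ^ ξ * n) t ++ u} := by
  ext p
  rw [Gam, graph_add_one]
  simp only [Gam]
  simp
  grind

/-- Members of `Γ_{ξ,1}` are nonempty with entries below `ω ^ ξ`, and have unique weights. -/
def Good (ξ : Ordinal.{v}) : Prop :=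
  (∀ t ∈ Gam ξ 1, t ≠ [] ∧ ∀ b ∈ t, b < ω ^ ξ) ∧
    ∀ t r r', (t, r) ∈ graph ξ 1 → (t, r') ∈ graph ξ 1 → r = r'

theorem mem_Gam_of_mem_graph {ξ : Ordinal.{v}} {n : ℕ} {t : List Ordinal.{v}} {r : ℝ}
    (h : (t, r) ∈ graph ξ n) : t ∈ Gam ξ n := ⟨_, h, rfl⟩

theorem shift_ge {ζ : Ordinal.{v}} {t : List Ordinal.{v}} {b : Ordinal.{v}} (h : b ∈ shift ζ t) :
    ζ ≤ b := by
  simp only [shift, List.mem_map] at h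
  obtain ⟨c, -, rfl⟩ := h
  exact le_self_add

theorem Good.bound {ξ : Ordinal.{v}} (h : Good ξ) (n : ℕ) :
    ∀ t ∈ Gam ξ (n + 1), (∃ a l, t = a :: l ∧ ω ^ ξ * n ≤ a) ∧
      ∀ b ∈ t, b < ω ^ ξ * (n + 1 : ℕ) := by
  have key : ∀ (m : ℕ), ∀ s ∈ Gam ξ 1, (∃ a l, shift (ω ^ ξ * m) s = a :: l ∧ ω ^ ξ * m ≤ a) ∧
      ∀ b ∈ shift (ω ^ ξ * m) s, b < ω ^ ξ * (m + 1 : ℕ) := by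
    intro m s hs
    obtain ⟨h1, h2⟩ := h.1 s hs
    constructor
    · cases s with
      | nil => exact absurd rfl h1
      | cons a l => exact ⟨_, _, rfl, le_self_add⟩
    · intro b hb
      simp only [shift, List.mem_map] at hb
      obtain ⟨c, hc, rfl⟩ := hb
      push_cast
      rw [mul_add_one]
      gcongr
      exact h2 c hc
  induction n with
  | zero =>
    intro t ht
    have := key 0 t ht
    simpa [shift_zero] using this
  | succ n ih =>
    intro t ht
    rw [Gam_add_one] at ht
    rcases ht with ⟨s, hs, rfl⟩ | ⟨s, hs, u, hu, rfl⟩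
    · exact key _ s hs
    · obtain ⟨⟨a, l, h1, h2⟩, h3⟩ := key (n + 1) s hs.1
      obtain ⟨-, h4⟩ := ih u hu
      refine ⟨⟨a, l ++ u, by rw [h1]; rfl, h2⟩, fun b hb => ?_⟩
      rcases List.mem_append.1 hb with hb | hb
      · exact h3 b hb
      · refine (h4 b hb).trans_le ?_
        gcongr
        omega

theorem split_unique {c : Ordinal.{v}} {s s' u u' : List Ordinal.{v}}
    (hs : ∀ b ∈ s, c ≤ b) (hs' : ∀ b ∈ s', c ≤ b) (hu : ∀ b ∈ u, b < c) (hu' : ∀ b ∈ u', b < c)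
    (h : s ++ u = s' ++ u') : s = s' ∧ u = u' := by
  induction s generalizing s' with
  | nil =>
    cases s' with
    | nil => simpa using h
    | cons a l =>
      have := hu a (by simp at h; simp [h])
      exact absurd (hs' a (by simp)) (not_le.2 this)
  | cons a l ih =>
    cases s' with
    | nil =>
      have := hu' a (by simp at h; simp [← h])
      exact absurd (hs a (by simp)) (not_le.2 this)
    | cons a' l' =>
      simp only [List.cons_append, List.cons.injEq] at h
      obtain ⟨h1, h2⟩ := ih (fun b hb => hs b (by simp [hb])) (fun b hb => hs' b (by simp [hb])) h.2
      exact ⟨by rw [h.1, h1], h2⟩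

theorem Good.unique {ξ : Ordinal.{v}} (h : Good ξ) (n : ℕ) :
    ∀ t r r', (t, r) ∈ graph ξ n → (t, r') ∈ graph ξ n → r = r' := by
  induction n with
  | zero => intro t r r' h1; simp [graph, stackGraph] at h1
  | succ n ih =>
    have hb : ∀ u ∈ Gam ξ n, u ≠ [] ∧ ∀ b ∈ u, b < ω ^ ξ * n := by
      intro u hu
      cases n with
      | zero => simp [Gam, graph, stackGraph] at hu
      | succ m =>
        obtain ⟨⟨a, l, h1, -⟩, h2⟩ := h.bound m u hu
        exact ⟨by simp [h1], h2⟩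
    intro t r r' h1 h2
    rw [graph_add_one] at h1 h2
    rcases h1 with ⟨s, x, hs, e⟩ | ⟨s, hs, u, x, hu, e⟩ <;>
    rcases h2 with ⟨s', x', hs', e'⟩ | ⟨s', hs', u', x', hu', e'⟩ <;>
    simp only [Prod.mk.injEq] at e e' <;> obtain ⟨e, rfl⟩ := e <;> obtain ⟨e', rfl⟩ := e'
    · rw [e] at e'
      rw [shift_injective _ e'] at hs
      exact h.2 _ _ _ hs hs'
    · obtain ⟨h3, h4⟩ := hb u' (mem_Gam_of_mem_graph hu')
      have := split_unique (u := []) (fun b => shift_ge) (fun b => shift_ge) (by simp) h4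
        (by simpa using e.symm.trans e')
      exact absurd this.2.symm h3
    · obtain ⟨h3, h4⟩ := hb u (mem_Gam_of_mem_graph hu)
      have := split_unique (u := []) (fun b => shift_ge) (fun b => shift_ge) (by simp) h4
        (by simpa using e'.symm.trans e)
      exact absurd this.2.symm h3
    · have := split_unique (fun b => shift_ge) (fun b => shift_ge)
        (hb u (mem_Gam_of_mem_graph hu)).2 (hb u' (mem_Gam_of_mem_graph hu')).2 (e.symm.trans e')
      rw [this.2] at hu
      exact ih _ _ _ hu hu'

theorem good (ξ : Ordinal.{v}) : Good ξ := by
  induction ξ using Ordinal.limitRecOn with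
  | zero =>
    constructor
    · intro t ht
      rw [Gam_zero_one] at ht
      obtain rfl : t = [0] := ht
      simp
    · intro t r r' h h'
      rw [graph_zero_one] at h h'
      simp at h h'
      rw [h.2, h'.2]
  | add_one ξ ih =>
    constructor
    · intro t ht
      rw [Gam_succ_one] at ht
      simp only [Set.mem_iUnion] at ht
      obtain ⟨n, hn, ht⟩ := ht
      obtain ⟨m, rfl⟩ := Nat.exists_eq_add_of_le' hn
      obtain ⟨⟨a, l, h1, -⟩, h2⟩ := ih.bound m t ht
      refine ⟨by simp [h1], fun b hb => (h2 b hb).trans ?_⟩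
      rw [Ordinal.opow_add, Ordinal.opow_one]
      gcongr
      · exact Ordinal.opow_pos _ Ordinal.omega0_pos
      · exact Ordinal.natCast_lt_omega0 _
    · intro t r r' h h'
      rw [graph_succ_one] at h h'
      obtain ⟨n, hn, s, x, hs, e⟩ := h
      obtain ⟨n', hn', s', x', hs', e'⟩ := h'
      simp only [Prod.mk.injEq] at e e'
      obtain ⟨rfl, rfl⟩ := e
      obtain ⟨rfl, rfl⟩ := e'
      obtain ⟨m, rfl⟩ := Nat.exists_eq_add_of_le' hn
      obtain ⟨m', rfl⟩ := Nat.exists_eq_add_of_le' hn'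
      obtain ⟨⟨a, l, rfl, h1⟩, h2⟩ := ih.bound m t (mem_Gam_of_mem_graph hs)
      obtain ⟨⟨a', l', e, h1'⟩, h2'⟩ := ih.bound m' _ (mem_Gam_of_mem_graph hs')
      obtain ⟨rfl, rfl⟩ := List.cons.inj e
      have e1 := lt_of_mul_lt_mul_left' (h1.trans_lt (h2' a (by simp)))
      have e2 := lt_of_mul_lt_mul_left' (h1'.trans_lt (h2 a (by simp)))
      have : m = m' := by
        have e1 : m < m' + 1 := by exact_mod_cast e1
        have e2 : m' < m + 1 := by exact_mod_cast e2
        omega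
      subst this
      rw [ih.unique _ _ _ _ hs hs']
  | limit ξ hξ ih =>
    have hb : ∀ ζ < ξ, ∀ t ∈ Gam (ζ + 1) 1, ∃ a l, shift (ω ^ ζ) t = a :: l ∧ ω ^ ζ ≤ a ∧
        ∀ b ∈ shift (ω ^ ζ) t, b < ω ^ (ζ + 1) := by
      intro ζ hζ t ht
      obtain ⟨h1, h2⟩ := (ih (ζ + 1) (hξ.add_one_lt hζ)).1 t ht
      cases t with
      | nil => exact absurd rfl h1
      | cons a l =>
        refine ⟨_, _, rfl, le_self_add, fun b hb => ?_⟩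
        simp only [shift, List.mem_map] at hb
        obtain ⟨c, hc, rfl⟩ := hb
        refine Ordinal.isPrincipal_add_omega0_opow _ ?_ (h2 c hc)
        exact (Ordinal.opow_lt_opow_iff_right Ordinal.one_lt_omega0).2 (Order.lt_add_one_iff.2 le_rfl)
    constructor
    · intro t ht
      rw [Gam_limit_one ξ hξ] at ht
      simp only [Set.mem_iUnion] at ht
      obtain ⟨ζ, hζ, s, hs, rfl⟩ := ht
      obtain ⟨a, l, h1, -, h2⟩ := hb ζ hζ s hs
      refine ⟨by simp [h1], fun b hb => (h2 b hb).trans_le ?_⟩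
      exact Ordinal.opow_le_opow_right Ordinal.omega0_pos (hξ.add_one_lt hζ).le
    · intro t r r' h h'
      rw [graph_limit_one ξ hξ] at h h'
      obtain ⟨ζ, hζ, s, x, hs, e⟩ := h
      obtain ⟨ζ', hζ', s', x', hs', e'⟩ := h'
      simp only [Prod.mk.injEq] at e e'
      obtain ⟨rfl, rfl⟩ := e
      obtain ⟨e', rfl⟩ := e'
      obtain ⟨a, l, h1, h2, h3⟩ := hb ζ hζ s (mem_Gam_of_mem_graph hs)
      obtain ⟨a', l', h1', h2', h3'⟩ := hb ζ' hζ' s' (mem_Gam_of_mem_graph hs')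
      obtain ⟨rfl, rfl⟩ := List.cons.inj (h1.symm.trans (e'.trans h1'))
      have e1 := (Ordinal.opow_lt_opow_iff_right Ordinal.one_lt_omega0).1
        (h2.trans_lt (h3' a (by simp [h1'])))
      have e2 := (Ordinal.opow_lt_opow_iff_right Ordinal.one_lt_omega0).1
        (h2'.trans_lt (h3 a (by simp [h1])))
      obtain rfl : ζ = ζ' := le_antisymm (Order.lt_add_one_iff.1 e1) (Order.lt_add_one_iff.1 e2)
      rw [shift_injective _ e'] at hs
      exact (ih (ζ + 1) (hξ.add_one_lt hζ)).2 _ _ _ hs hs'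

/-- `ℙ_{ξ,n}(t)` is the only number that is paired with `t` in the graph. -/
theorem weight_eq {ξ : Ordinal.{v}} {n : ℕ} {t : List Ordinal.{v}} {r : ℝ}
    (h : (t, r) ∈ graph ξ n) : weight ξ n t = r := by
  have h' : ∃ r, (t, r) ∈ graph ξ n := ⟨r, h⟩
  rw [weight, dif_pos h']
  exact (good ξ).unique n _ _ _ h'.choose_spec h

/-! ### Weakly null collections and the quantities `θ_{ξ,n}` -/

section Operators

variable (𝕜 : Type w) [RCLike 𝕜]

/-- The directed set `D_X` of all weakly open subsets of `X` that contain `0`, directed by reverse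
inclusion. -/
abbrev WeakNhds (X : Type u) [NormedAddCommGroup X] [NormedSpace 𝕜 X] : Type u :=
  (TopologicalSpace.OpenNhdsOf (0 : WeakSpace 𝕜 X))ᵒᵈ

/-- The collection `(x_t)_{t ∈ T.D}` is weakly null: for each `t` (empty or in `T.D`) and `ζ` such
that the sequences `t ⌢ (ζ, u)` belong to `T.D`, the net `(x_{t ⌢ (ζ, u)})_{u ∈ D}` is weakly null.
The values of `x` outside `T.D` play no role. -/
def IsWeaklyNull {Λ : Type*} (T : Set (List Λ)) {D : Type*} [Preorder D]
    {X : Type u} [NormedAddCommGroup X] [NormedSpace 𝕜 X] (x : List (Λ × D) → X) : Prop :=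
  ∀ (t : List (Λ × D)) (ζ : Λ), t.map Prod.fst ++ [ζ] ∈ T →
    Filter.Tendsto (fun u : D => toWeakSpace 𝕜 X (x (t ++ [(ζ, u)]))) Filter.atTop (𝓝 0)

/-- The set `𝓑^X_{ξ,n}` of all weakly null collections `(x_t)_{t ∈ Γ_{ξ,n}.D_X}` in the closed unit
ball of `X`. -/
def nullCollections (ξ : Ordinal.{v}) (n : ℕ) (X : Type u) [NormedAddCommGroup X]
    [NormedSpace 𝕜 X] : Set (List (Ordinal.{v} × WeakNhds 𝕜 X) → X) :=
  {x | IsWeaklyNull 𝕜 (Gam ξ n) x ∧ ∀ t ∈ treeProd (Gam ξ n) (WeakNhds 𝕜 X), ‖x t‖ ≤ 1}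

variable {𝕜}
variable {X Y : Type u} [NormedAddCommGroup X] [NormedSpace 𝕜 X]
  [NormedAddCommGroup Y] [NormedSpace 𝕜 Y]

open Classical in
/-- The vector `∑ᵢ aᵢ ∑ ℙ_{ξ,n}(s) x_s`, where `i` runs through the `n` levels and the inner sum is
over all nonempty initial segments `s` of `t` in the `i`-th level of `Γ_{ξ,n}.D_X`. -/
def branchSum (ξ : Ordinal.{v}) (n : ℕ) (a : ℕ →₀ 𝕜)
    (x : List (Ordinal.{v} × WeakNhds 𝕜 X) → X) (t : List (Ordinal.{v} × WeakNhds 𝕜 X)) : X :=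
  ∑ i ∈ Finset.range n, a i •
    ∑ k ∈ (Finset.Icc 1 t.length).filter (fun k => (t.take k).map Prod.fst ∈ level ξ n i),
      ((weight ξ n ((t.take k).map Prod.fst) : ℝ) : 𝕜) • x (t.take k)

/-- The seminorm `‖·‖_{ξ,A}` on `c₀₀`, the coordinates being counted from zero. -/
def seminormOf (ξ : Ordinal.{v}) (A : X →L[𝕜] Y) (a : ℕ →₀ 𝕜) : ℝ≥0∞ :=
  ⨆ n : ℕ, ⨆ _ : 1 ≤ n, ⨆ x ∈ nullCollections 𝕜 ξ n X,
    ⨅ t ∈ maxNodes (treeProd (Gam ξ n) (WeakNhds 𝕜 X)), ‖A (branchSum ξ n a x t)‖ₑ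

/-- `θ_{ξ,n}(A) = ‖n⁻¹ (e₁ + ⋯ + eₙ)‖_{ξ,A}`. -/
def theta (ξ : Ordinal.{v}) (n : ℕ) (A : X →L[𝕜] Y) : ℝ≥0∞ :=
  seminormOf ξ A ((n : 𝕜)⁻¹ • ∑ i ∈ Finset.range n, Finsupp.single i 1)

/-- `N_{ξ,p}(A) = sup_{n ≥ 1} n^{1/q} θ_{ξ,n}(A)`, where `1/p + 1/q = 1`. -/
def supN (ξ : Ordinal.{v}) (p : ℝ≥0∞) (A : X →L[𝕜] Y) : ℝ≥0∞ :=
  ⨆ n : ℕ, ⨆ _ : 1 ≤ n, (n : ℝ≥0∞) ^ (p.conjExponent⁻¹).toReal * theta ξ n A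

variable (𝕜) in
/-- The component `𝔑_{ξ,p}(X, Y)` of the class `𝔑_{ξ,p}`. -/
def classN (ξ : Ordinal.{v}) (p : ℝ≥0∞) (X Y : Type u) [NormedAddCommGroup X] [NormedSpace 𝕜 X]
    [NormedAddCommGroup Y] [NormedSpace 𝕜 Y] : Set (X →L[𝕜] Y) :=
  {A | supN ξ p A < ∞}

/-- `𝔫_{ξ,p}(A) = ‖A‖ + N_{ξ,p}(A)`, for `A ∈ 𝔑_{ξ,p}`. -/
def normN (ξ : Ordinal.{v}) (p : ℝ≥0∞) (A : X →L[𝕜] Y) : ℝ :=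
  ‖A‖ + (supN ξ p A).toReal

end Operators

/-! ### Banach ideals -/

/-- A class of operators between Banach spaces, given by its components. -/
abbrev OperatorClass (𝕜 : Type w) [RCLike 𝕜] :=
  ∀ (X Y : Type u) [NormedAddCommGroup X] [NormedSpace 𝕜 X] [CompleteSpace X]
    [NormedAddCommGroup Y] [NormedSpace 𝕜 Y] [CompleteSpace Y], Set (X →L[𝕜] Y)

/-- A real-valued function of operators between Banach spaces. -/
abbrev OperatorFunction (𝕜 : Type w) [RCLike 𝕜] :=
  ∀ (X Y : Type u) [NormedAddCommGroup X] [NormedSpace 𝕜 X] [CompleteSpace X]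
    [NormedAddCommGroup Y] [NormedSpace 𝕜 Y] [CompleteSpace Y], (X →L[𝕜] Y) → ℝ

/-- Operator ideals: each component is a linear subspace that contains the operators of rank one,
and the class is stable under composition with bounded operators on both sides. -/
structure IsOperatorIdeal {𝕜 : Type w} [RCLike 𝕜] (J : OperatorClass.{u} 𝕜) : Prop where
  rank_one_mem : ∀ (X Y : Type u) [NormedAddCommGroup X] [NormedSpace 𝕜 X] [CompleteSpace X]
    [NormedAddCommGroup Y] [NormedSpace 𝕜 Y] [CompleteSpace Y] (f : StrongDual 𝕜 X) (y : Y),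
    f.smulRight y ∈ J X Y
  add_mem : ∀ (X Y : Type u) [NormedAddCommGroup X] [NormedSpace 𝕜 X] [CompleteSpace X]
    [NormedAddCommGroup Y] [NormedSpace 𝕜 Y] [CompleteSpace Y] (A B : X →L[𝕜] Y),
    A ∈ J X Y → B ∈ J X Y → A + B ∈ J X Y
  smul_mem : ∀ (X Y : Type u) [NormedAddCommGroup X] [NormedSpace 𝕜 X] [CompleteSpace X]
    [NormedAddCommGroup Y] [NormedSpace 𝕜 Y] [CompleteSpace Y] (c : 𝕜) (A : X →L[𝕜] Y),
    A ∈ J X Y → c • A ∈ J X Y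
  comp_mem : ∀ (W X Y Z : Type u) [NormedAddCommGroup W] [NormedSpace 𝕜 W] [CompleteSpace W]
    [NormedAddCommGroup X] [NormedSpace 𝕜 X] [CompleteSpace X]
    [NormedAddCommGroup Y] [NormedSpace 𝕜 Y] [CompleteSpace Y]
    [NormedAddCommGroup Z] [NormedSpace 𝕜 Z] [CompleteSpace Z]
    (C : W →L[𝕜] X) (A : X →L[𝕜] Y) (B : Y →L[𝕜] Z), A ∈ J X Y → B ∘L A ∘L C ∈ J W Z

/-- Ideal norms on a class of operators. -/
structure IsIdealNorm {𝕜 : Type w} [RCLike 𝕜] (J : OperatorClass.{u} 𝕜)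
    (ι : OperatorFunction.{u} 𝕜) : Prop where
  nonneg : ∀ (X Y : Type u) [NormedAddCommGroup X] [NormedSpace 𝕜 X] [CompleteSpace X]
    [NormedAddCommGroup Y] [NormedSpace 𝕜 Y] [CompleteSpace Y] (A : X →L[𝕜] Y),
    A ∈ J X Y → 0 ≤ ι X Y A
  eq_zero_iff : ∀ (X Y : Type u) [NormedAddCommGroup X] [NormedSpace 𝕜 X] [CompleteSpace X]
    [NormedAddCommGroup Y] [NormedSpace 𝕜 Y] [CompleteSpace Y] (A : X →L[𝕜] Y),
    A ∈ J X Y → (ι X Y A = 0 ↔ A = 0)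
  add_le : ∀ (X Y : Type u) [NormedAddCommGroup X] [NormedSpace 𝕜 X] [CompleteSpace X]
    [NormedAddCommGroup Y] [NormedSpace 𝕜 Y] [CompleteSpace Y] (A B : X →L[𝕜] Y),
    A ∈ J X Y → B ∈ J X Y → ι X Y (A + B) ≤ ι X Y A + ι X Y B
  smul_eq : ∀ (X Y : Type u) [NormedAddCommGroup X] [NormedSpace 𝕜 X] [CompleteSpace X]
    [NormedAddCommGroup Y] [NormedSpace 𝕜 Y] [CompleteSpace Y] (c : 𝕜) (A : X →L[𝕜] Y),
    A ∈ J X Y → ι X Y (c • A) = ‖c‖ * ι X Y A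
  rank_one : ∀ (X Y : Type u) [NormedAddCommGroup X] [NormedSpace 𝕜 X] [CompleteSpace X]
    [NormedAddCommGroup Y] [NormedSpace 𝕜 Y] [CompleteSpace Y] (f : StrongDual 𝕜 X) (y : Y),
    ι X Y (f.smulRight y) = ‖f‖ * ‖y‖
  comp_le : ∀ (W X Y Z : Type u) [NormedAddCommGroup W] [NormedSpace 𝕜 W] [CompleteSpace W]
    [NormedAddCommGroup X] [NormedSpace 𝕜 X] [CompleteSpace X]
    [NormedAddCommGroup Y] [NormedSpace 𝕜 Y] [CompleteSpace Y]
    [NormedAddCommGroup Z] [NormedSpace 𝕜 Z] [CompleteSpace Z]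
    (C : W →L[𝕜] X) (A : X →L[𝕜] Y) (B : Y →L[𝕜] Z), A ∈ J X Y →
    ι W Z (B ∘L A ∘L C) ≤ ‖B‖ * ι X Y A * ‖C‖

/-- Banach ideals: operator ideals with an ideal norm for which all components are complete. -/
structure IsBanachIdeal {𝕜 : Type w} [RCLike 𝕜] (J : OperatorClass.{u} 𝕜)
    (ι : OperatorFunction.{u} 𝕜) : Prop where
  ideal : IsOperatorIdeal J
  norm : IsIdealNorm J ι
  complete : ∀ (X Y : Type u) [NormedAddCommGroup X] [NormedSpace 𝕜 X] [CompleteSpace X]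
    [NormedAddCommGroup Y] [NormedSpace 𝕜 Y] [CompleteSpace Y] (A : ℕ → X →L[𝕜] Y),
    (∀ n, A n ∈ J X Y) →
    (∀ ε : ℝ, 0 < ε → ∃ N, ∀ m ≥ N, ∀ n ≥ N, ι X Y (A m - A n) < ε) →
    ∃ B ∈ J X Y, Filter.Tendsto (fun n => ι X Y (A n - B)) Filter.atTop (𝓝 0)

end SzlenkIdeal

end

noncomputable section

namespace SzlenkIdeal

/-! ### The filter of weakly null vectors in the unit ball -/

section Game

variable (𝕜 : Type w) [RCLike 𝕜] (X : Type u) [NormedAddCommGroup X] [NormedSpace 𝕜 X]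

/-! The obstacle is the triangle inequality for `θ_{ξ,n}` as a function of the operator: for a given
collection the infima belonging to `A` and to `B` may be approached on different branches, so the
two bounds cannot simply be added. The remedy is to read "supremum over collections of the infimum
over branches" as the value of a game, `Forces`. One player picks the next ordinal and a weak
neighbourhood of `0`, the other answers with a vector of the unit ball in it, and the weighted
answers are summed. If the value is less than `c`, the first player can force `‖A x‖ < c`; otherwise
the answers that avoid his winning positions would form a weakly null collection that is bad on
every branch (`forces_of_value_lt`). Conversely, a strategy finds a good branch in every collection
(`value_le_of_forces`).

By the recursion for `Γ_{ξ,n}` the game is an iteration of monotone operators `Op ξ a` on sets of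
vectors, and the triangle inequality reduces to `Op ξ a S ∩ Op ξ a T ⊆ Op ξ a (S ∩ T)`
(`Op_inter_subset`), proved by induction on `ξ`. For `ξ = 0` this is the intersection property of a
filter. At `ξ + 1` the first player chooses `n` and then plays `n` games of level `ξ` with
coefficient `a / n`. Two strategies may choose different numbers `N` and `M`, but both can be
refined to `N * M` games by `Op_subset_iterate`, which rests on averages of weakly null vectors
being weakly null. At a limit both strategies are moved to the larger of two ordinals, since `Op`
increases with `ξ`.

The other properties are softer. Strategies are transported along contractions, which gives the
ideal inequality. Functionals tend to zero along weakly null vectors, so `N_{ξ,p}` vanishes on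
operators of rank one. Each `θ_{ξ,n}` is bounded by a multiple of the operator norm, so `N_{ξ,p}` is
lower semicontinuous and completeness follows. -/

/-- The trace on the closed unit ball of the filter of weak neighbourhoods of `0`. -/
def nullFilter : Filter X :=
  Filter.comap (toWeakSpace 𝕜 X) (𝓝 0) ⊓ Filter.principal {x | ‖x‖ ≤ 1}

theorem pure_zero_le_nullFilter : pure 0 ≤ nullFilter 𝕜 X := by
  refine le_inf ?_ (by simp)
  rw [← Filter.map_le_iff_le_comap, Filter.map_pure, map_zero]
  exact pure_le_nhds 0

instance nullFilter_neBot : (nullFilter 𝕜 X).NeBot :=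
  Filter.neBot_of_le (pure_zero_le_nullFilter 𝕜 X)

variable {𝕜 X}

theorem tendsto_nullFilter {α : Type*} {l : Filter α} {f : α → X} :
    Filter.Tendsto f l (nullFilter 𝕜 X) ↔
      Filter.Tendsto (fun i => toWeakSpace 𝕜 X (f i)) l (𝓝 0) ∧ ∀ᶠ i in l, ‖f i‖ ≤ 1 := by
  simp [nullFilter, Filter.tendsto_inf, Filter.tendsto_comap_iff, Function.comp_def]

theorem eventually_norm_le_one : ∀ᶠ y in nullFilter 𝕜 X, ‖y‖ ≤ 1 :=
  (tendsto_nullFilter.1 Filter.tendsto_id).2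

theorem tendsto_toWeakSpace_nullFilter :
    Filter.Tendsto (toWeakSpace 𝕜 X) (nullFilter 𝕜 X) (𝓝 0) :=
  (tendsto_nullFilter.1 Filter.tendsto_id).1

/-- Functionals tend to zero along weakly null vectors. -/
theorem tendsto_apply_nullFilter (f : StrongDual 𝕜 X) :
    Filter.Tendsto f (nullFilter 𝕜 X) (𝓝 0) := by
  have h : Continuous fun x : WeakSpace 𝕜 X => f ((toWeakSpace 𝕜 X).symm x) :=
    WeakBilin.eval_continuous (topDualPairing 𝕜 X).flip f
  have := (h.tendsto 0).comp (tendsto_toWeakSpace_nullFilter (𝕜 := 𝕜) (X := X))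
  simpa [Function.comp_def] using this

/-- Contractions preserve weakly null vectors of the unit ball. -/
theorem tendsto_clm_nullFilter {W : Type u} [NormedAddCommGroup W] [NormedSpace 𝕜 W]
    (C : W →L[𝕜] X) (hC : ‖C‖ ≤ 1) :
    Filter.Tendsto C (nullFilter 𝕜 W) (nullFilter 𝕜 X) := by
  refine tendsto_nullFilter.2 ⟨?_, ?_⟩
  · have := ((WeakSpace.map C).continuous.tendsto 0).comp
      (tendsto_toWeakSpace_nullFilter (𝕜 := 𝕜) (X := W))
    rw [map_zero] at this
    exact this
  · filter_upwards [eventually_norm_le_one (𝕜 := 𝕜) (X := W)] with y hy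
    calc ‖C y‖ ≤ ‖C‖ * ‖y‖ := C.le_opNorm y
      _ ≤ 1 * 1 := by gcongr
      _ = 1 := one_mul 1

/-- Convex combinations of two weakly null vectors of the unit ball. -/
theorem tendsto_convex_nullFilter {r s : ℝ} (hr : 0 ≤ r) (hs : 0 ≤ s) (h : r + s = 1) :
    Filter.Tendsto (fun q : X × X => (r : 𝕜) • q.1 + (s : 𝕜) • q.2)
      (nullFilter 𝕜 X ×ˢ nullFilter 𝕜 X) (nullFilter 𝕜 X) := by
  have hw := tendsto_toWeakSpace_nullFilter (𝕜 := 𝕜) (X := X)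
  refine tendsto_nullFilter.2 ⟨?_, ?_⟩
  · have := ((hw.comp Filter.tendsto_fst).const_smul (r : 𝕜)).add
      ((hw.comp (Filter.tendsto_snd (f := nullFilter 𝕜 X))).const_smul (s : 𝕜))
    simpa [Function.comp_def] using this
  · have hb := eventually_norm_le_one (𝕜 := 𝕜) (X := X)
    filter_upwards [hb.prod_mk hb] with q hq
    calc ‖(r : 𝕜) • q.1 + (s : 𝕜) • q.2‖ ≤ ‖(r : 𝕜) • q.1‖ + ‖(s : 𝕜) • q.2‖ := norm_add_le _ _
      _ = r * ‖q.1‖ + s * ‖q.2‖ := by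
        rw [norm_smul, norm_smul, RCLike.norm_ofReal, RCLike.norm_ofReal, abs_of_nonneg hr,
          abs_of_nonneg hs]
      _ ≤ r * 1 + s * 1 := by gcongr <;> simp [hq]
      _ = 1 := by simpa using h

/-! ### The game on a weighted tree -/

variable {Λ : Type*}

/-- The tree of all continuations of `ζ` in `T`. -/
def residual (T : Set (List Λ)) (ζ : Λ) : Set (List Λ) := {s | ζ :: s ∈ T}

@[simp]
theorem mem_residual {T : Set (List Λ)} {ζ : Λ} {s : List Λ} :
    s ∈ residual T ζ ↔ ζ :: s ∈ T := Iff.rfl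

/-- Two players move along the tree `T`, starting from its root and from the vector `z`. In each
round the first one chooses a letter `ζ` that extends the present node to a node `s` of `T`, and a
set in the filter `nullFilter`; the second one chooses a vector `y` in this set, and `w s • y` is
added to the present vector. `Forces S T w z` says that the first player can force the play to end,
and to end in the set `S`. -/
inductive Forces (S : Set X) : Set (List Λ) → (List Λ → 𝕜) → X → Prop
  | leaf {T : Set (List Λ)} {w : List Λ → 𝕜} {z : X} (hT : ∀ s ∈ T, s = []) (hz : z ∈ S) :
      Forces S T w z
  | step {T : Set (List Λ)} {w : List Λ → 𝕜} {z : X} (ζ : Λ) (hζ : [ζ] ∈ T) (U : Set X)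
      (hU : U ∈ nullFilter 𝕜 X)
      (h : ∀ y ∈ U, Forces S (residual T ζ) (fun s => w (ζ :: s)) (z + w [ζ] • y)) :
      Forces S T w z

theorem Forces.of_eventually {S : Set X} {T : Set (List Λ)} {w : List Λ → 𝕜} {z : X} (ζ : Λ)
    (hζ : [ζ] ∈ T) (h : ∀ᶠ y in nullFilter 𝕜 X,
      Forces S (residual T ζ) (fun s => w (ζ :: s)) (z + w [ζ] • y)) : Forces S T w z :=
  .step ζ hζ _ h fun _ hy => hy

theorem Forces.mono {S S' : Set X} (hS : S ⊆ S') {T : Set (List Λ)} {w : List Λ → 𝕜} {z : X}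
    (h : Forces S T w z) : Forces S' T w z := by
  induction h with
  | leaf hT hz => exact .leaf hT (hS hz)
  | step ζ hζ U hU _ ih => exact .step ζ hζ U hU ih

/-- If `C` is a contraction, every small weakly null answer in `W` yields a legal answer in `X`, so
the strategy in `X` can be followed. As the game does not mention the index sets `D_W` and `D_X`, no
collection has to be reindexed. -/
theorem Forces.of_map {W : Type u} [NormedAddCommGroup W] [NormedSpace 𝕜 W] (C : W →L[𝕜] X)
    (hC : ‖C‖ ≤ 1) {S : Set X} {T : Set (List Λ)} {w : List Λ → 𝕜} {z : W}
    (h : Forces S T w (C z)) : Forces (C ⁻¹' S) T w z := by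
  generalize hx : C z = x at h
  induction h generalizing z with
  | leaf hT hz => exact .leaf hT (by simpa [hx] using hz)
  | step ζ hζ U hU _ ih =>
    exact .step ζ hζ _ (tendsto_clm_nullFilter C hC hU) fun y hy => ih (C y) hy (by simp [hx])

/-! ### Relabelling, disjoint unions and concatenation of game trees. -/

theorem residual_image {Λ' : Type*} {f : Λ → Λ'} (hf : Function.Injective f)
    (T : Set (List Λ)) (ζ : Λ) :
    residual (List.map f '' T) (f ζ) = List.map f '' residual T ζ := by
  ext s
  constructor
  · rintro ⟨t, ht, e⟩
    cases t with
    | nil => simp at e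
    | cons a l =>
      simp only [List.map_cons, List.cons.injEq] at e
      obtain rfl := hf e.1
      exact ⟨l, ht, e.2⟩
  · rintro ⟨t, ht, rfl⟩
    exact ⟨ζ :: t, ht, rfl⟩

/-- The game depends only on the shape of the weighted tree. -/
theorem Forces.relabel {Λ' : Type*} {S : Set X} {f : Λ → Λ'} (hf : Function.Injective f)
    {T : Set (List Λ)} {w : List Λ → 𝕜} {w' : List Λ' → 𝕜} {z : X}
    (hw : ∀ s ∈ T, s ≠ [] → w' (s.map f) = w s) (h : Forces S T w z) :
    Forces S (List.map f '' T) w' z := by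
  induction h generalizing w' with
  | leaf hT hz =>
    refine .leaf ?_ hz
    rintro _ ⟨s, hs, rfl⟩
    simp [hT s hs]
  | @step T w z ζ hζ U hU _ ih =>
    refine .step (f ζ) ⟨[ζ], hζ, rfl⟩ U hU fun y hy => ?_
    have e := hw [ζ] hζ (by simp)
    simp only [List.map_cons, List.map_nil] at e
    rw [residual_image hf, e]
    exact ih y hy fun s hs _ => hw (ζ :: s) hs (by simp)

theorem Forces.congr {S : Set X} {T : Set (List Λ)} {w w' : List Λ → 𝕜} {z : X}
    (hw : ∀ s ∈ T, s ≠ [] → w' s = w s) (h : Forces S T w z) : Forces S T w' z := by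
  simpa using h.relabel (f := id) (w' := w') Function.injective_id (by simpa using hw)

theorem Forces.of_relabel {Λ' : Type*} {S : Set X} {f : Λ → Λ'} (hf : Function.Injective f)
    {T : Set (List Λ)} {w : List Λ → 𝕜} {w' : List Λ' → 𝕜} {z : X}
    (hw : ∀ s ∈ T, s ≠ [] → w' (s.map f) = w s) (h : Forces S (List.map f '' T) w' z) :
    Forces S T w z := by
  generalize hT' : List.map f '' T = T' at h
  induction h generalizing T w with
  | leaf hT hz =>
    subst hT'
    exact .leaf (fun s hs => by simpa using hT _ ⟨s, hs, rfl⟩) hz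
  | @step T' w' z ζ' hζ U hU _ ih =>
    subst hT'
    obtain ⟨t, ht, e⟩ := hζ
    obtain ⟨ζ, rfl, rfl⟩ : ∃ ζ, t = [ζ] ∧ f ζ = ζ' := by
      cases t with
      | nil => simp at e
      | cons a l => simp at e; exact ⟨a, by simp [e.2], e.1⟩
    refine .step ζ ht U hU fun y hy => ?_
    have e := hw [ζ] ht (by simp)
    simp only [List.map_cons, List.map_nil] at e
    rw [← e]
    exact ih y hy (fun s hs _ => hw (ζ :: s) hs (by simp))
      (residual_image hf T ζ).symm

theorem forces_relabel {Λ' : Type*} {S : Set X} {f : Λ → Λ'} (hf : Function.Injective f)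
    {T : Set (List Λ)} {w : List Λ → 𝕜} {w' : List Λ' → 𝕜} {z : X}
    (hw : ∀ s ∈ T, s ≠ [] → w' (s.map f) = w s) :
    Forces S (List.map f '' T) w' z ↔ Forces S T w z :=
  ⟨.of_relabel hf hw, .relabel hf hw⟩

theorem forces_congr {S : Set X} {T : Set (List Λ)} {w w' : List Λ → 𝕜} {z : X}
    (hw : ∀ s ∈ T, s ≠ [] → w' s = w s) : Forces S T w' z ↔ Forces S T w z :=
  ⟨.congr fun s hs h => (hw s hs h).symm, .congr hw⟩

/-- In a disjoint union of trees the first move is the choice of a tree. -/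
theorem forces_iUnion {ι : Type*} [Nonempty ι] {S : Set X} {T : ι → Set (List Λ)}
    {w : List Λ → 𝕜} {z : X} (hT : ∀ i, [] ∉ T i) (hne : ∀ i, (T i).Nonempty)
    (hd : ∀ i j ζ s s', ζ :: s ∈ T i → ζ :: s' ∈ T j → i = j) :
    Forces S (⋃ i, T i) w z ↔ ∃ i, Forces S (T i) w z := by
  -- By `hd` the first letter determines the tree, so after it the union has become a single tree.
  have hr : ∀ i ζ, [ζ] ∈ T i → residual (⋃ i, T i) ζ = residual (T i) ζ := by
    intro i ζ h
    ext s
    simp only [mem_residual, Set.mem_iUnion]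
    refine ⟨fun ⟨j, hj⟩ => ?_, fun h' => ⟨i, h'⟩⟩
    rwa [hd i j ζ _ _ h hj]
  have hl : ∀ i, ¬ ∀ s ∈ T i, s = [] := by
    intro i h
    obtain ⟨s, hs⟩ := hne i
    exact hT i (h s hs ▸ hs)
  constructor
  · intro h
    cases h with
    | leaf h _ =>
      obtain ⟨i⟩ := ‹Nonempty ι›
      exact absurd (fun s hs => h s (Set.mem_iUnion.2 ⟨i, hs⟩)) (hl i)
    | step ζ hζ U hU h =>
      obtain ⟨i, hi⟩ := Set.mem_iUnion.1 hζ
      rw [hr i ζ hi] at h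
      exact ⟨i, .step ζ hi U hU h⟩
  · rintro ⟨i, h⟩
    cases h with
    | leaf h _ => exact absurd h (hl i)
    | step ζ hi U hU h =>
      rw [← hr i ζ hi] at h
      exact .step ζ (Set.mem_iUnion.2 ⟨i, hi⟩) U hU h

/-- The tree in which the maximal members of `T₁` are continued by `T₂`. -/
def concat (T₁ T₂ : Set (List Λ)) : Set (List Λ) :=
  T₁ ∪ {p | ∃ t ∈ maxNodes T₁, ∃ u ∈ T₂, p = t ++ u}

theorem mem_maxNodes_residual {T : Set (List Λ)} {ζ : Λ} {t : List Λ} :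
    t ∈ maxNodes (residual T ζ) ↔ ζ :: t ∈ maxNodes T := by
  constructor
  · rintro ⟨h1, h2⟩
    refine ⟨h1, fun s hs hp => ?_⟩
    obtain ⟨r, rfl⟩ := hp
    have := h2 (t ++ r) hs ⟨r, rfl⟩
    simp [this]
  · rintro ⟨h1, h2⟩
    refine ⟨h1, fun s hs hp => ?_⟩
    simpa using h2 (ζ :: s) hs (by simpa using hp)

theorem eq_nil_of_nil_mem_maxNodes {T : Set (List Λ)} (h : [] ∈ maxNodes T) :
    ∀ s ∈ T, s = [] := fun s hs => h.2 s hs List.nil_prefix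

/-- When `T₁` is trivial its root may be maximal, and the first letter would then be taken from
`T₂`; hence the hypothesis. -/
theorem residual_concat {T₁ T₂ : Set (List Λ)} (h : ¬ ∀ s ∈ T₁, s = []) (ζ : Λ) :
    residual (concat T₁ T₂) ζ = concat (residual T₁ ζ) T₂ := by
  ext s
  constructor
  · rintro (hs | ⟨t, ht, u, hu, e⟩)
    · exact Or.inl hs
    · cases t with
      | nil => exact absurd (eq_nil_of_nil_mem_maxNodes ht) h
      | cons a l =>
        simp only [List.cons_append, List.cons.injEq] at e
        obtain ⟨rfl, rfl⟩ := e
        exact Or.inr ⟨l, mem_maxNodes_residual.2 ht, u, hu, rfl⟩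
  · rintro (hs | ⟨t, ht, u, hu, rfl⟩)
    · exact Or.inl hs
    · exact Or.inr ⟨ζ :: t, mem_maxNodes_residual.1 ht, u, hu, rfl⟩

theorem singleton_mem_concat {T₁ T₂ : Set (List Λ)} (h : ¬ ∀ s ∈ T₁, s = []) {ζ : Λ} :
    [ζ] ∈ concat T₁ T₂ ↔ [ζ] ∈ T₁ := by
  refine ⟨?_, Or.inl⟩
  rintro (hs | ⟨t, ht, u, hu, e⟩)
  · exact hs
  · cases t with
    | nil => exact absurd (eq_nil_of_nil_mem_maxNodes ht) h
    | cons a l =>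
      simp only [List.cons_append, List.cons.injEq] at e
      obtain ⟨rfl, e⟩ := e
      obtain ⟨rfl, rfl⟩ := List.append_eq_nil_iff.1 e.symm
      exact ht.1

/-- The game does not see whether the root belongs to the tree. Residual trees contain `[]` while
the `Γ_{ξ,n}` do not, so both forms occur. -/
theorem forces_insert_nil {S : Set X} {T : Set (List Λ)} {w : List Λ → 𝕜} {z : X} :
    Forces S (insert [] T) w z ↔ Forces S T w z := by
  have hr : ∀ ζ, residual (insert [] T) ζ = residual T ζ := by intro ζ; ext s; simp
  constructor <;> intro h
  · cases h with
    | leaf h hz => exact .leaf (fun s hs => h s (Or.inr hs)) hz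
    | step ζ hζ U hU h =>
      rw [hr] at h
      exact .step ζ (by simpa using hζ) U hU h
  · cases h with
    | leaf h hz => exact .leaf (by simpa using h) hz
    | step ζ hζ U hU h =>
      rw [← hr] at h
      exact .step ζ (Or.inr hζ) U hU h

theorem forces_concat_of_trivial {S : Set X} {T₁ T₂ : Set (List Λ)} {w w₁ w₂ : List Λ → 𝕜} {z : X}
    (ht : ∀ s ∈ T₁, s = []) (hne : T₁.Nonempty)
    (hw₂ : ∀ t ∈ maxNodes T₁, ∀ u ∈ T₂, u ≠ [] → w (t ++ u) = w₂ u) :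
    Forces S (concat T₁ T₂) w z ↔ Forces {x | Forces S T₂ w₂ x} T₁ w₁ z := by
  obtain rfl : T₁ = {[]} := by
    obtain ⟨s, hs⟩ := hne
    ext t
    exact ⟨ht t, fun h => by rw [h, ← ht s hs]; exact hs⟩
  have hm : ([] : List Λ) ∈ maxNodes {[]} := ⟨rfl, fun s hs _ => hs⟩
  have hc : concat {[]} T₂ = insert [] T₂ := by
    ext s
    constructor
    · rintro (h | ⟨t, ht, u, hu, rfl⟩)
      · exact Or.inl h
      · obtain rfl : t = [] := ht.1
        exact Or.inr hu
    · rintro (h | h)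
      · exact Or.inl h
      · exact Or.inr ⟨[], hm, s, h, rfl⟩
  rw [hc, forces_insert_nil, forces_congr (w' := w) (w := w₂) fun u hu h => hw₂ [] hm u hu h]
  refine ⟨fun h => .leaf ht h, fun h => ?_⟩
  cases h with
  | leaf _ h => exact h
  | step ζ hζ => simp at hζ

/-- The positions from which the second game is won serve as the target set of the first game. All
hypotheses pass to residual trees, so both directions follow by induction on the strategy. -/
theorem forces_concat {S : Set X} {T₁ T₂ : Set (List Λ)} {w w₁ w₂ : List Λ → 𝕜} {z : X}
    (hne : T₁.Nonempty) (hw₁ : ∀ t ∈ T₁, t ≠ [] → w t = w₁ t)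
    (hw₂ : ∀ t ∈ maxNodes T₁, ∀ u ∈ T₂, u ≠ [] → w (t ++ u) = w₂ u) :
    Forces S (concat T₁ T₂) w z ↔ Forces {x | Forces S T₂ w₂ x} T₁ w₁ z := by
  constructor
  · intro h
    generalize hT : concat T₁ T₂ = T at h
    induction h generalizing T₁ w₁ with
    | @leaf T w z h hz =>
      subst hT
      have ht : ∀ s ∈ T₁, s = [] := fun s hs => h s (Or.inl hs)
      exact (forces_concat_of_trivial ht hne hw₂).1 (.leaf h hz)
    | @step T w z ζ hζ U hU h ih =>
      subst hT
      by_cases ht : ∀ s ∈ T₁, s = []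
      · exact (forces_concat_of_trivial ht hne hw₂).1 (.step ζ hζ U hU h)
      · rw [singleton_mem_concat ht] at hζ
        refine .step ζ hζ U hU fun y hy => ?_
        rw [← hw₁ [ζ] hζ (by simp)]
        exact ih y hy ⟨[], hζ⟩ (fun t h _ => hw₁ (ζ :: t) h (by simp))
          (fun t h u hu hu' => hw₂ (ζ :: t) (mem_maxNodes_residual.1 h) u hu hu')
          (residual_concat ht ζ).symm
  · intro h
    induction h generalizing w with
    | @leaf T₁ w₁ z h hz => exact (forces_concat_of_trivial (w₁ := w₁) h hne hw₂).2 (.leaf h hz)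
    | @step T₁ w₁ z ζ hζ U hU h ih =>
      have ht : ¬ ∀ s ∈ T₁, s = [] := fun ht => by simpa using ht [ζ] hζ
      refine .step ζ ((singleton_mem_concat ht).2 hζ) U hU fun y hy => ?_
      rw [residual_concat ht, hw₁ [ζ] hζ (by simp)]
      exact ih y hy ⟨[], hζ⟩ (fun t h _ => hw₁ (ζ :: t) h (by simp))
        (fun t h u hu hu' => hw₂ (ζ :: t) (mem_maxNodes_residual.1 h) u hu hu')

/-! ### The game and weakly null collections -/

/-- The sum of the vectors `w s • x_s` over the nonempty initial segments `s` of `t`. -/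
def pathSum {D : Type*} : (List Λ → 𝕜) → (List (Λ × D) → X) → List (Λ × D) → X
  | _, _, [] => 0
  | w, x, q :: t => w [q.1] • x [q] + pathSum (fun s => w (q.1 :: s)) (fun s => x (q :: s)) t

theorem pathSum_eq_sum {D : Type*} (w : List Λ → 𝕜) (x : List (Λ × D) → X) (t : List (Λ × D)) :
    pathSum w x t = ∑ k ∈ Finset.Icc 1 t.length, w ((t.take k).map Prod.fst) • x (t.take k) := by
  induction t generalizing w x with
  | nil => simp [pathSum]
  | cons q t ih =>
    have hsum : ∀ (n : ℕ) (f : ℕ → X),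
        ∑ k ∈ Finset.Icc 1 n, f k = ∑ k ∈ Finset.range n, f (k + 1) := by
      intro n f
      have : Finset.Icc 1 n = Finset.Ico 1 (n + 1) := by ext; simp
      rw [this, Finset.sum_Ico_eq_sum_range]
      simp [add_comm]
    rw [pathSum, ih, hsum, hsum, List.length_cons, Finset.sum_range_succ', add_comm]
    simp

/-- The collection plays the second player: for the prescribed letter `ζ`, weak nullness supplies an
index `v` whose vector lies in the prescribed set `U`. -/
theorem Forces.exists_branch {D : Type*} [Preorder D] [IsDirectedOrder D] [Nonempty D]
    {S : Set X} {T : Set (List Λ)} {w : List Λ → 𝕜} {z : X} (h : Forces S T w z)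
    (hne : T.Nonempty) {x : List (Λ × D) → X}
    (hx : IsWeaklyNull 𝕜 T x) (hb : ∀ t ∈ treeProd T D, ‖x t‖ ≤ 1) :
    ∃ t : List (Λ × D), t.map Prod.fst ∈ maxNodes T ∧ z + pathSum w x t ∈ S := by
  induction h generalizing x with
  | @leaf T w z hT hz =>
    refine ⟨[], ⟨?_, fun s hs _ => hT s hs⟩, by simpa [pathSum] using hz⟩
    obtain ⟨s, hs⟩ := hne
    simpa [hT s hs] using hs
  | @step T w z ζ hζ U hU _ ih =>
    have h1 : Filter.Tendsto (fun v : D => x [(ζ, v)]) Filter.atTop (nullFilter 𝕜 X) :=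
      tendsto_nullFilter.2 ⟨hx [] ζ hζ, .of_forall fun v => hb _ hζ⟩
    obtain ⟨v, hv⟩ := (h1.eventually_mem hU).exists
    obtain ⟨t, ht, h2⟩ := ih _ hv ⟨[], hζ⟩ (x := fun s => x ((ζ, v) :: s))
      (fun t η h => hx ((ζ, v) :: t) η h) (fun t h => hb ((ζ, v) :: t) h)
    exact ⟨(ζ, v) :: t, mem_maxNodes_residual.1 ht, by simpa [pathSum, add_assoc] using h2⟩

open Classical in
/-- A move of the second player in the weak neighbourhood `v`, which avoids a position that the
first player wins if this is possible. -/
def reply (S : Set X) (T : Set (List Λ)) (w : List Λ → 𝕜) (z : X) (q : Λ × WeakNhds 𝕜 X) : X :=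
  if h : ∃ y, toWeakSpace 𝕜 X y ∈ OrderDual.ofDual q.2 ∧ ‖y‖ ≤ 1 ∧
    ¬ Forces S (residual T q.1) (fun s => w (q.1 :: s)) (z + w [q.1] • y) then h.choose else 0

theorem reply_mem (S : Set X) (T : Set (List Λ)) (w : List Λ → 𝕜) (z : X)
    (q : Λ × WeakNhds 𝕜 X) :
    toWeakSpace 𝕜 X (reply S T w z q) ∈ OrderDual.ofDual q.2 ∧ ‖reply S T w z q‖ ≤ 1 := by
  rw [reply]
  split_ifs with h
  · exact ⟨h.choose_spec.1, h.choose_spec.2.1⟩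
  -- The default value `0` is a legal answer, since it lies in every neighbourhood.
  · refine ⟨?_, by simp⟩
    rw [map_zero]
    exact (OrderDual.ofDual q.2).mem

/-- If every vector of the unit ball in the neighbourhood led to a win of the first player, he could
choose this letter and this neighbourhood now and would win from the present position. -/
theorem not_forces_reply {S : Set X} {T : Set (List Λ)} {w : List Λ → 𝕜} {z : X}
    (h : ¬ Forces S T w z) (q : Λ × WeakNhds 𝕜 X) (hq : [q.1] ∈ T) :
    ¬ Forces S (residual T q.1) (fun s => w (q.1 :: s)) (z + w [q.1] • reply S T w z q) := by
  have hex : ∃ y, toWeakSpace 𝕜 X y ∈ OrderDual.ofDual q.2 ∧ ‖y‖ ≤ 1 ∧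
      ¬ Forces S (residual T q.1) (fun s => w (q.1 :: s)) (z + w [q.1] • y) := by
    by_contra! hn
    refine h (.of_eventually q.1 hq ?_)
    have h1 := tendsto_toWeakSpace_nullFilter.eventually_mem
      ((OrderDual.ofDual q.2).isOpen.mem_nhds (OrderDual.ofDual q.2).mem)
    filter_upwards [h1, eventually_norm_le_one (𝕜 := 𝕜)] with y hy1 hy2
    exact hn y hy1 hy2
  rw [reply, dif_pos hex]
  exact hex.choose_spec.2.2

/-- The collection of vectors that the second player chooses by the rule `reply`. -/
def replies (S : Set X) : Set (List Λ) → (List Λ → 𝕜) → X → List (Λ × WeakNhds 𝕜 X) → X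
  | _, _, _, [] => 0
  | T, w, z, [q] => reply S T w z q
  | T, w, z, q :: q' :: t =>
      replies S (residual T q.1) (fun s => w (q.1 :: s)) (z + w [q.1] • reply S T w z q) (q' :: t)

theorem replies_cons {S : Set X} {T : Set (List Λ)} {w : List Λ → 𝕜} {z : X}
    {q : Λ × WeakNhds 𝕜 X} {t : List (Λ × WeakNhds 𝕜 X)} (ht : t ≠ []) :
    replies S T w z (q :: t) = replies S (residual T q.1) (fun s => w (q.1 :: s))
      (z + w [q.1] • reply S T w z q) t := by
  cases t with
  | nil => exact absurd rfl ht
  | cons a l => rfl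

theorem norm_replies_le (S : Set X) (T : Set (List Λ)) (w : List Λ → 𝕜) (z : X)
    (t : List (Λ × WeakNhds 𝕜 X)) : ‖replies S T w z t‖ ≤ 1 := by
  induction t generalizing T w z with
  | nil => simp [replies]
  | cons q t ih =>
    by_cases ht : t = []
    · subst ht
      exact (reply_mem S T w z q).2
    · rw [replies_cons ht]
      exact ih _ _ _

theorem replies_mem (S : Set X) (T : Set (List Λ)) (w : List Λ → 𝕜) (z : X)
    (t : List (Λ × WeakNhds 𝕜 X)) (q : Λ × WeakNhds 𝕜 X) :
    toWeakSpace 𝕜 X (replies S T w z (t ++ [q])) ∈ OrderDual.ofDual q.2 := by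
  induction t generalizing T w z with
  | nil => exact (reply_mem S T w z q).1
  | cons a t ih =>
    rw [List.cons_append, replies_cons (by simp)]
    exact ih _ _ _

theorem isWeaklyNull_replies (S : Set X) (T T' : Set (List Λ)) (w : List Λ → 𝕜) (z : X) :
    IsWeaklyNull 𝕜 T' (replies S T w z) := by
  intro t ζ _ V hV
  obtain ⟨V', hV', ho, h0⟩ := mem_nhds_iff.1 hV
  rw [Filter.mem_map]
  -- The vector with last index `(ζ, v)` lies in `v`, so all indices beyond an open `V' ⊆ V` are
  -- good.
  refine Filter.mem_of_superset (Filter.mem_atTop (OrderDual.toDual (⟨⟨V', ho⟩, h0⟩ :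
    TopologicalSpace.OpenNhdsOf (0 : WeakSpace 𝕜 X)))) fun v hv => ?_
  exact hV' (hv (replies_mem S T w z t (ζ, v)))

theorem pathSum_congr {D : Type*} {w : List Λ → 𝕜} {x x' : List (Λ × D) → X} (t : List (Λ × D))
    (h : ∀ s, s ≠ [] → x s = x' s) : pathSum w x t = pathSum w x' t := by
  cases t with
  | nil => rfl
  | cons q t =>
    rw [pathSum_eq_sum, pathSum_eq_sum]
    refine Finset.sum_congr rfl fun k hk => ?_
    rw [h]
    simp only [Finset.mem_Icc] at hk
    simp only [ne_eq, List.take_eq_nil_iff]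
    simp
    omega

/-- Losing positions are kept along the whole branch. Closure under initial segments makes each
letter of the branch a legal move; finiteness of the single branch is all the well-foundedness that
is used. -/
theorem pathSum_replies_notMem {S : Set X} {T : Set (List Λ)}
    (hT : ∀ s t, s ≠ [] → s ++ t ∈ T → s ∈ T) {w : List Λ → 𝕜} {z : X} (h : ¬ Forces S T w z)
    {t : List (Λ × WeakNhds 𝕜 X)} (ht : t.map Prod.fst ∈ maxNodes T) :
    z + pathSum w (replies S T w z) t ∉ S := by
  induction t generalizing T w z with
  | nil =>
    intro hz
    exact h (.leaf (eq_nil_of_nil_mem_maxNodes ht) (by simpa [pathSum] using hz))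
  | cons q t ih =>
    have hq : [q.1] ∈ T := hT _ (t.map Prod.fst) (by simp) ht.1
    have := ih (fun s t hs hst => hT (q.1 :: s) t (by simp) hst) (not_forces_reply h q hq)
      (mem_maxNodes_residual.2 ht)
    rw [pathSum, pathSum_congr t fun s hs => replies_cons hs, ← add_assoc]
    exact this

end Game

/-! ### Structure of the trees `Γ_{ξ,n}` -/

theorem mem_graph_weight {ξ : Ordinal.{v}} {n : ℕ} {t : List Ordinal.{v}} (h : t ∈ Gam ξ n) :
    (t, weight ξ n t) ∈ graph ξ n := by
  obtain ⟨⟨s, r⟩, hr, rfl⟩ := h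
  rwa [weight_eq hr]

theorem Gam_zero_right (ξ : Ordinal.{v}) : Gam ξ 0 = ∅ := by
  simp [Gam, graph, stackGraph]

theorem Gam_one_nonempty (ξ : Ordinal.{v}) : (Gam ξ 1).Nonempty := by
  induction ξ using Ordinal.limitRecOn with
  | zero => rw [Gam_zero_one]; exact Set.singleton_nonempty _
  | add_one ξ ih =>
    obtain ⟨t, ht⟩ := ih
    refine ⟨t, ?_⟩
    rw [Gam_succ_one]
    simp only [Set.mem_iUnion]
    exact ⟨1, le_rfl, ht⟩
  | limit ξ hξ ih =>
    obtain ⟨t, ht⟩ := ih (0 + 1) (hξ.add_one_lt hξ.bot_lt)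
    refine ⟨shift (ω ^ (0 : Ordinal.{v})) t, ?_⟩
    rw [Gam_limit_one ξ hξ]
    exact Set.mem_biUnion (x := 0) hξ.bot_lt ⟨t, ht, rfl⟩

theorem Gam_nonempty (ξ : Ordinal.{v}) {n : ℕ} (hn : 1 ≤ n) : (Gam ξ n).Nonempty := by
  obtain ⟨m, rfl⟩ := Nat.exists_eq_add_of_le' hn
  obtain ⟨t, ht⟩ := Gam_one_nonempty ξ
  rw [Gam_add_one]
  exact ⟨_, Or.inl ⟨t, ht, rfl⟩⟩

theorem ne_nil_and_lt_of_mem_Gam {ξ : Ordinal.{v}} {n : ℕ} {u : List Ordinal.{v}}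
    (hu : u ∈ Gam ξ n) : u ≠ [] ∧ ∀ b ∈ u, b < ω ^ ξ * n := by
  cases n with
  | zero => simp [Gam_zero_right] at hu
  | succ m =>
    obtain ⟨⟨a, l, h1, -⟩, h2⟩ := (good ξ).bound m u hu
    exact ⟨by simp [h1], h2⟩

theorem nil_notMem_Gam (ξ : Ordinal.{v}) (n : ℕ) : [] ∉ Gam ξ n :=
  fun h => (ne_nil_and_lt_of_mem_Gam h).1 rfl

theorem maxNodes_shift (c : Ordinal.{v}) (T : Set (List Ordinal.{v})) :
    maxNodes (shift c '' T) = shift c '' maxNodes T := by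
  ext t
  constructor
  · rintro ⟨⟨s, hs, rfl⟩, h⟩
    refine ⟨s, ⟨hs, fun r hr hp => ?_⟩, rfl⟩
    exact shift_injective c (h _ ⟨r, hr, rfl⟩ (hp.map _))
  · rintro ⟨s, hs, rfl⟩
    refine ⟨⟨s, hs.1, rfl⟩, ?_⟩
    rintro _ ⟨r, hr, rfl⟩ hp
    rw [hs.2 r hr]
    exact (List.prefix_map_iff_of_injective fun _ _ h => by simpa using h).1 hp

theorem Gam_add_one_eq_concat (ξ : Ordinal.{v}) (n : ℕ) :
    Gam ξ (n + 1) = concat (shift (ω ^ ξ * n) '' Gam ξ 1) (Gam ξ n) := by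
  rw [Gam_add_one, concat, maxNodes_shift]
  ext p
  simp [eq_comm]

/-- The set of finite sequences is closed under nonempty initial segments. -/
def PrefixClosed {Λ : Type*} (T : Set (List Λ)) : Prop :=
  ∀ s t, s ≠ [] → s ++ t ∈ T → s ∈ T

theorem PrefixClosed.shift {T : Set (List Ordinal.{v})} (h : PrefixClosed T) (c : Ordinal.{v}) :
    PrefixClosed (shift c '' T) := by
  rintro s t hs ⟨r, hr, e⟩
  obtain ⟨r₁, r₂, rfl, rfl, rfl⟩ := List.map_eq_append_iff.1 e
  exact ⟨r₁, h _ _ (by simpa using hs) hr, rfl⟩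

theorem PrefixClosed.concat {Λ : Type*} {T₁ T₂ : Set (List Λ)} (h₁ : PrefixClosed T₁)
    (h₂ : PrefixClosed T₂) : PrefixClosed (concat T₁ T₂) := by
  rintro s t hs (h | ⟨r, hr, u, hu, e⟩)
  · exact Or.inl (h₁ _ _ hs h)
  · rcases List.append_eq_append_iff.1 e with ⟨r', rfl, rfl⟩ | ⟨s', rfl, rfl⟩
    · exact Or.inl (h₁ _ _ hs hr.1)
    · by_cases h : s' = []
      · subst h
        exact Or.inl (by simpa using hr.1)
      · exact Or.inr ⟨r, hr, s', h₂ _ _ h hu, rfl⟩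

theorem prefixClosed_Gam_of_one {ξ : Ordinal.{v}} (h : PrefixClosed (Gam ξ 1)) (n : ℕ) :
    PrefixClosed (Gam ξ n) := by
  induction n with
  | zero => intro s t _ h; simp [Gam_zero_right] at h
  | succ n ih =>
    rw [Gam_add_one_eq_concat]
    exact (h.shift _).concat ih

theorem prefixClosed_Gam (ξ : Ordinal.{v}) (n : ℕ) : PrefixClosed (Gam ξ n) := by
  refine prefixClosed_Gam_of_one ?_ n
  induction ξ using Ordinal.limitRecOn with
  | zero =>
    rw [Gam_zero_one]
    intro s t hs h
    cases s with
    | nil => exact absurd rfl hs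
    | cons a l =>
      simp at h
      simp [h]
  | add_one ξ ih =>
    rw [Gam_succ_one]
    intro s t hs h
    simp only [Set.mem_iUnion] at h ⊢
    obtain ⟨n, hn, h⟩ := h
    exact ⟨n, hn, prefixClosed_Gam_of_one ih n s t hs h⟩
  | limit ξ hξ ih =>
    rw [Gam_limit_one ξ hξ]
    intro s t hs h
    simp only [Set.mem_iUnion] at h ⊢
    obtain ⟨ζ, hζ, h⟩ := h
    exact ⟨ζ, hζ, (ih _ (hξ.add_one_lt hζ)).shift _ s t hs h⟩

/-! ### Recursion formulas for the weights and the levels. -/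

theorem weight_shift {ξ : Ordinal.{v}} {n : ℕ} {s : List Ordinal.{v}} (hs : s ∈ Gam ξ 1) :
    weight ξ (n + 1) (shift (ω ^ ξ * n) s) = weight ξ 1 s := by
  refine weight_eq ?_
  rw [graph_add_one]
  exact Or.inl ⟨s, _, mem_graph_weight hs, rfl⟩

theorem weight_append {ξ : Ordinal.{v}} {n : ℕ} {t u : List Ordinal.{v}}
    (ht : t ∈ maxNodes (Gam ξ 1)) (hu : u ∈ Gam ξ n) :
    weight ξ (n + 1) (shift (ω ^ ξ * n) t ++ u) = weight ξ n u := by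
  refine weight_eq ?_
  rw [graph_add_one]
  exact Or.inr ⟨t, ht, u, _, mem_graph_weight hu, rfl⟩

theorem weight_succ_one {ξ : Ordinal.{v}} {n : ℕ} (hn : 1 ≤ n) {t : List Ordinal.{v}}
    (ht : t ∈ Gam ξ n) : weight (ξ + 1) 1 t = (n : ℝ)⁻¹ * weight ξ n t := by
  refine weight_eq ?_
  rw [graph_succ_one]
  exact ⟨n, hn, t, _, mem_graph_weight ht, rfl⟩

theorem weight_limit_one {ξ ζ : Ordinal.{v}} (hξ : Order.IsSuccLimit ξ) (hζ : ζ < ξ)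
    {t : List Ordinal.{v}} (ht : t ∈ Gam (ζ + 1) 1) :
    weight ξ 1 (shift (ω ^ ζ) t) = weight (ζ + 1) 1 t := by
  refine weight_eq ?_
  rw [graph_limit_one ξ hξ]
  exact ⟨ζ, hζ, t, _, mem_graph_weight ht, rfl⟩

theorem level_subset_Gam (ξ : Ordinal.{v}) (n i : ℕ) : level ξ n i ⊆ Gam ξ n := by
  induction n generalizing i with
  | zero => simp [level]
  | succ n ih =>
    rw [Gam_add_one]
    cases i with
    | zero => exact Set.subset_union_left
    | succ i =>
      rintro p ⟨t, ht, u, hu, rfl⟩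
      exact Or.inr ⟨t, ht, u, ih i hu, rfl⟩

theorem shift_mem_level_succ_iff {ξ : Ordinal.{v}} {n i : ℕ} {s : List Ordinal.{v}}
    (hs : s ∈ Gam ξ 1) : shift (ω ^ ξ * n) s ∈ level ξ (n + 1) i ↔ i = 0 := by
  cases i with
  | zero => exact iff_of_true ⟨s, hs, rfl⟩ rfl
  | succ i =>
    refine iff_of_false ?_ (by simp)
    rintro ⟨t, ht, u, hu, e⟩
    obtain ⟨h1, h2⟩ := ne_nil_and_lt_of_mem_Gam (level_subset_Gam ξ n i hu)
    -- The two pieces of a concatenation are recovered from its entries: those of the first are at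
    -- least `ω ^ ξ * n`, those of the second are below it.
    have := split_unique (u := []) (fun b => shift_ge) (fun b => shift_ge) (by simp) h2
      (by simpa using e)
    exact h1 this.2.symm

theorem append_notMem_level_zero {ξ : Ordinal.{v}} {n : ℕ} {t u : List Ordinal.{v}}
    (hu : u ∈ Gam ξ n) : shift (ω ^ ξ * n) t ++ u ∉ level ξ (n + 1) 0 := by
  rintro ⟨s, hs, e⟩
  obtain ⟨h1, h2⟩ := ne_nil_and_lt_of_mem_Gam hu
  have := split_unique (u' := []) (fun b => shift_ge) (fun b => shift_ge) h2 (by simp)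
    (by simpa using e)
  exact h1 this.2

theorem append_mem_level_succ_iff {ξ : Ordinal.{v}} {n i : ℕ} {t u : List Ordinal.{v}}
    (ht : t ∈ maxNodes (Gam ξ 1)) (hu : u ∈ Gam ξ n) :
    shift (ω ^ ξ * n) t ++ u ∈ level ξ (n + 1) (i + 1) ↔ u ∈ level ξ n i := by
  refine ⟨?_, fun h => ⟨t, ht, u, h, rfl⟩⟩
  rintro ⟨t', ht', u', hu', e⟩
  have := split_unique (fun b => shift_ge) (fun b => shift_ge) (ne_nil_and_lt_of_mem_Gam hu).2
    (ne_nil_and_lt_of_mem_Gam (level_subset_Gam ξ n i hu')).2 e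
  rwa [this.2]

/-! ### Branch sums as path sums of a single weight function. -/

section Operators

variable {𝕜 : Type w} [RCLike 𝕜] {X : Type u} [NormedAddCommGroup X] [NormedSpace 𝕜 X]

open Classical in
/-- The coefficient of `x_s` in the sum `∑ᵢ aᵢ ∑ ℙ_{ξ,n}(s) x_s`. -/
def coef (ξ : Ordinal.{v}) (n : ℕ) (a : ℕ → 𝕜) (s : List Ordinal.{v}) : 𝕜 :=
  (∑ i ∈ Finset.range n, if s ∈ level ξ n i then a i else 0) * (weight ξ n s : ℝ)

theorem coef_shift {ξ : Ordinal.{v}} {n : ℕ} {s : List Ordinal.{v}} (a : ℕ → 𝕜)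
    (hs : s ∈ Gam ξ 1) :
    coef ξ (n + 1) a (shift (ω ^ ξ * n) s) = a 0 * (weight ξ 1 s : ℝ) := by
  simp [coef, weight_shift hs, shift_mem_level_succ_iff hs]

theorem coef_append {ξ : Ordinal.{v}} {n : ℕ} {t u : List Ordinal.{v}} (a : ℕ → 𝕜)
    (ht : t ∈ maxNodes (Gam ξ 1)) (hu : u ∈ Gam ξ n) :
    coef ξ (n + 1) a (shift (ω ^ ξ * n) t ++ u) = coef ξ n (fun i => a (i + 1)) u := by
  classical
  rw [coef, coef, weight_append ht hu, Finset.sum_range_succ', if_neg (append_notMem_level_zero hu),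
    add_zero]
  congr 1
  exact Finset.sum_congr rfl fun i _ => if_congr (append_mem_level_succ_iff ht hu) rfl rfl

theorem branchSum_eq_pathSum (ξ : Ordinal.{v}) (n : ℕ) (a : ℕ →₀ 𝕜)
    (x : List (Ordinal.{v} × WeakNhds 𝕜 X) → X) (t : List (Ordinal.{v} × WeakNhds 𝕜 X)) :
    branchSum ξ n a x t = pathSum (coef ξ n a) x t := by
  classical
  rw [pathSum_eq_sum, branchSum]
  simp only [coef, Finset.sum_mul, Finset.sum_smul, Finset.smul_sum, Finset.sum_filter]
  rw [Finset.sum_comm]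
  refine Finset.sum_congr rfl fun k _ => Finset.sum_congr rfl fun i _ => ?_
  split_ifs <;> simp [mul_smul]

/-! ### The operators on sets given by the game on `Γ_{ξ,1}` -/

/-- The set of all vectors from which the first player can force the game on `Γ_{ξ,1}`, with the
weights `a ℙ_{ξ,1}`, to end in `S`. -/
def Op (ξ : Ordinal.{v}) (a : 𝕜) (S : Set X) : Set X :=
  {z | Forces S (Gam ξ 1) (fun s => a * (weight ξ 1 s : ℝ)) z}

theorem Op_mono (ξ : Ordinal.{v}) (a : 𝕜) : Monotone (Op (X := X) ξ a) :=
  fun _ _ h _ hz => Forces.mono h hz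

theorem forces_empty {Λ : Type*} {S : Set X} {w : List Λ → 𝕜} {z : X} :
    Forces S ∅ w z ↔ z ∈ S := by
  refine ⟨fun h => ?_, fun h => .leaf (by simp) h⟩
  cases h with
  | leaf _ h => exact h
  | step ζ hζ => simp at hζ

/-- The game on `Γ_{ξ,n+1}` is the game on `Γ_{ξ,1}` followed by the game on `Γ_{ξ,n}`. -/
theorem forces_Gam_add_one {ξ : Ordinal.{v}} {n : ℕ} {S : Set X} {a : 𝕜}
    {w w' : List Ordinal.{v} → 𝕜} {z : X}
    (h₁ : ∀ s ∈ Gam ξ 1, w (shift (ω ^ ξ * n) s) = a * (weight ξ 1 s : ℝ))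
    (h₂ : ∀ t ∈ maxNodes (Gam ξ 1), ∀ u ∈ Gam ξ n, w (shift (ω ^ ξ * n) t ++ u) = w' u) :
    Forces S (Gam ξ (n + 1)) w z ↔ z ∈ Op ξ a {x | Forces S (Gam ξ n) w' x} := by
  rw [Gam_add_one_eq_concat, forces_concat (w₁ := w) (w₂ := w') ((Gam_one_nonempty ξ).image _)
    (fun _ _ _ => rfl)]
  · exact forces_relabel (fun _ _ h => by simpa using h) fun s hs _ => h₁ s hs
  · rw [maxNodes_shift]
    rintro _ ⟨t, ht, rfl⟩ u hu _
    exact h₂ t ht u hu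

theorem forces_coef_add_one {ξ : Ordinal.{v}} {n : ℕ} {S : Set X} {a : ℕ → 𝕜} {z : X} :
    Forces S (Gam ξ (n + 1)) (coef ξ (n + 1) a) z ↔
      z ∈ Op ξ (a 0) {x | Forces S (Gam ξ n) (coef ξ n fun i => a (i + 1)) x} :=
  forces_Gam_add_one (fun _ hs => coef_shift a hs) fun _ ht _ hu => coef_append a ht hu

/-- With equal coefficients on all levels the game on `Γ_{ξ,n}` is an `n`-fold iterate; the empty
tree `Γ_{ξ,0}` starts the induction. -/
theorem forces_weight {ξ : Ordinal.{v}} {n : ℕ} {S : Set X} {a : 𝕜} {z : X} :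
    Forces S (Gam ξ n) (fun s => a * (weight ξ n s : ℝ)) z ↔ z ∈ (Op ξ a)^[n] S := by
  induction n generalizing z with
  | zero => rw [Gam_zero_right, forces_empty]; rfl
  | succ n ih =>
    rw [forces_Gam_add_one (a := a) (w' := fun s => a * (weight ξ n s : ℝ))
      (fun s hs => by rw [weight_shift hs]) (fun t ht u hu => by rw [weight_append ht hu]),
      Function.iterate_succ_apply']
    simp only [ih, Set.ofPred_mem_eq]

theorem mem_Op_zero {S : Set X} {a : 𝕜} {z : X} :
    z ∈ Op (0 : Ordinal.{v}) a S ↔ ∀ᶠ y in nullFilter 𝕜 X, z + a • y ∈ S := by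
  have hw : weight (0 : Ordinal.{v}) 1 [0] = 1 := weight_eq (by simp [graph_zero_one])
  have hr : residual {([0] : List Ordinal.{v})} 0 = {[]} := by ext s; simp
  rw [Op, Set.mem_ofPred_eq, Gam_zero_one]
  constructor
  · intro h
    cases h with
    | leaf h => simp at h
    | step ζ hζ U hU h =>
      obtain rfl : ζ = 0 := by simpa using hζ
      filter_upwards [hU] with y hy
      have := h y hy
      cases this with
      | leaf _ h => simpa [hw] using h
      | step η hη => simp at hη
  · intro h
    refine .of_eventually 0 rfl ?_
    filter_upwards [h] with y hy
    exact .leaf (by simp) (by simpa [hw] using hy)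

/-- The first letter fixes `n`, and the factor `n⁻¹` in the definition of `ℙ_{ξ+1,1}` turns the
coefficient `a` into `a / n`. -/
theorem mem_Op_succ {ξ : Ordinal.{v}} {S : Set X} {a : 𝕜} {z : X} :
    z ∈ Op (ξ + 1) a S ↔ ∃ n : ℕ, 1 ≤ n ∧ z ∈ (Op ξ (a / n))^[n] S := by
  have hU : Gam (ξ + 1) 1 = ⋃ m : ℕ, Gam ξ (m + 1) := by
    rw [Gam_succ_one]
    ext t
    simp only [Set.mem_iUnion]
    constructor
    · rintro ⟨n, hn, h⟩
      obtain ⟨m, rfl⟩ := Nat.exists_eq_add_of_le' hn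
      exact ⟨m, h⟩
    · rintro ⟨m, h⟩
      exact ⟨m + 1, by simp, h⟩
  -- The first letter of a member of `Γ_{ξ,i+1}` lies in `[ω ^ ξ * i, ω ^ ξ * (i + 1))`, and these
  -- intervals are disjoint.
  have hlt : ∀ i j (ζ : Ordinal.{v}) s s', ζ :: s ∈ Gam ξ (i + 1) → ζ :: s' ∈ Gam ξ (j + 1) →
      i ≤ j := by
    intro i j ζ s s' h h'
    obtain ⟨⟨_, _, e, h1⟩, -⟩ := (good ξ).bound i _ h
    obtain ⟨rfl, rfl⟩ := List.cons.inj e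
    have h2 := ((good ξ).bound j _ h').2 ζ (by simp)
    have := lt_of_mul_lt_mul_left' (h1.trans_lt h2)
    have : i < j + 1 := by exact_mod_cast this
    omega
  rw [Op, Set.mem_ofPred_eq, hU, forces_iUnion (fun i => nil_notMem_Gam ξ _)
    (fun i => Gam_nonempty ξ (by simp))
    (fun i j ζ s s' h h' => (hlt i j ζ s s' h h').antisymm (hlt j i ζ s' s h' h))]
  have key : ∀ m : ℕ, Forces S (Gam ξ (m + 1)) (fun s => a * (weight (ξ + 1) 1 s : ℝ)) z ↔
      z ∈ (Op ξ (a / (m + 1 : ℕ)))^[m + 1] S := by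
    intro m
    rw [← forces_weight]
    refine forces_congr fun s hs _ => ?_
    rw [weight_succ_one (by simp) hs]
    push_cast
    ring
  simp only [key]
  constructor
  · rintro ⟨m, h⟩
    exact ⟨m + 1, by simp, h⟩
  · rintro ⟨n, hn, h⟩
    obtain ⟨m, rfl⟩ := Nat.exists_eq_add_of_le' hn
    exact ⟨m, h⟩

theorem mem_Op_limit {ξ : Ordinal.{v}} (hξ : Order.IsSuccLimit ξ) {S : Set X} {a : 𝕜} {z : X} :
    z ∈ Op ξ a S ↔ ∃ ζ < ξ, z ∈ Op (ζ + 1) a S := by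
  have hU : Gam ξ 1 = ⋃ ζ : Set.Iio ξ, shift (ω ^ (ζ : Ordinal.{v})) '' Gam (ζ + 1) 1 := by
    rw [Gam_limit_one ξ hξ]
    ext t
    simp
  -- Here the first letter lies in `[ω ^ i, ω ^ (i + 1))`, because `ω ^ (i + 1)` is additively
  -- principal.
  have hlt : ∀ i j (ζ : Ordinal.{v}) s s', ζ :: s ∈ shift (ω ^ i) '' Gam (i + 1) 1 →
      ζ :: s' ∈ shift (ω ^ j) '' Gam (j + 1) 1 → i ≤ j := by
    rintro i j ζ s s' ⟨t, ht, e⟩ ⟨t', ht', e'⟩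
    have h1 : ω ^ i ≤ ζ := shift_ge (t := t) (by simp [e])
    have h2 : ζ ∈ shift (ω ^ j) t' := by simp [e']
    simp only [shift, List.mem_map] at h2
    obtain ⟨c, hc, rfl⟩ := h2
    have h2 := Ordinal.isPrincipal_add_omega0_opow (j + 1)
      ((Ordinal.opow_lt_opow_iff_right Ordinal.one_lt_omega0).2 (Order.lt_add_one_iff.2 le_rfl))
      (((good (j + 1)).1 t' ht').2 c hc)
    exact Order.lt_add_one_iff.1
      ((Ordinal.opow_lt_opow_iff_right Ordinal.one_lt_omega0).1 (h1.trans_lt h2))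
  have : Nonempty (Set.Iio ξ) := ⟨⟨0, hξ.bot_lt⟩⟩
  rw [Op, Set.mem_ofPred_eq, hU, forces_iUnion]
  · have key : ∀ ζ : Set.Iio ξ, Forces S (shift (ω ^ (ζ : Ordinal.{v})) '' Gam (ζ + 1) 1)
        (fun s => a * (weight ξ 1 s : ℝ)) z ↔ z ∈ Op ((ζ : Ordinal.{v}) + 1) a S := by
      intro ζ
      refine forces_relabel (fun _ _ h => by simpa using h) fun s hs _ => ?_
      have := weight_limit_one hξ ζ.2 hs
      rw [shift] at this
      rw [this]
    simp only [key]
    simp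
  · rintro i ⟨t, ht, e⟩
    obtain rfl : t = [] := by simpa [shift] using e
    exact nil_notMem_Gam _ _ ht
  · exact fun i => (Gam_one_nonempty _).image _
  · exact fun i j ζ s s' h h' =>
      Subtype.ext ((hlt i j ζ s s' h h').antisymm (hlt j i ζ s' s h' h))

end Operators

/-! ### Splitting of rounds, the intersection property and bounds by seminorms. -/

section Operators

variable {𝕜 : Type w} [RCLike 𝕜] {X : Type u} [NormedAddCommGroup X] [NormedSpace 𝕜 X]

/-- A round with coefficient `a` can be split into `M` rounds with coefficient `a / M`: averages of
weakly null vectors are weakly null. -/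
theorem Op_zero_subset_iterate (a : 𝕜) (S : Set X) {M : ℕ} (hM : 1 ≤ M) :
    Op (0 : Ordinal.{v}) a S ⊆ (Op (0 : Ordinal.{v}) (a / M))^[M] S := by
  intro z hz
  have hM0 : (M : 𝕜) ≠ 0 := by
    have : M ≠ 0 := by omega
    exact_mod_cast this
  -- Here `k` rounds remain and `y` is the average of the `M - k` answers given so far. The
  -- induction runs backwards in time, from the end of the play at `k = 0`.
  have key : ∀ k ≤ M, ∀ᶠ y in nullFilter 𝕜 X,
      z + (a / M * ((M - k : ℕ) : 𝕜)) • y ∈ (Op (0 : Ordinal.{v}) (a / M))^[k] S := by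
    intro k
    induction k with
    | zero =>
      intro _
      rw [mem_Op_zero] at hz
      simpa [hM0] using hz
    | succ k ih =>
      intro hk
      obtain ⟨j, hj⟩ : ∃ j, M - k = j + 1 := ⟨M - (k + 1), by omega⟩
      have hj' : M - (k + 1) = j := by omega
      have h0 : ((j : ℝ) + 1) ≠ 0 := by positivity
      have h0' : ((j : 𝕜) + 1) ≠ 0 := by exact_mod_cast j.succ_ne_zero
      -- An average of `j + 1` vectors is `j / (j + 1)` times the average of the first `j` plus `1 /
      -- (j + 1)` times the last. Currying then fixes the old average before the new answer is
      -- given.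
      have hc := tendsto_convex_nullFilter (𝕜 := 𝕜) (X := X) (r := j / (j + 1)) (s := 1 / (j + 1))
        (by positivity) (by positivity) (by field_simp)
      have := (hc.eventually (ih (by omega))).curry
      rw [Function.iterate_succ_apply', hj']
      filter_upwards [this] with x hx
      rw [mem_Op_zero]
      filter_upwards [hx] with y hy
      convert hy using 1
      rw [hj, add_assoc, smul_add, smul_smul, smul_smul]
      congr 3
      · push_cast; field_simp
      · push_cast; field_simp
  -- At `k = M` the coefficient of `y` is zero, so any one `y` will do; the filter is proper.
  obtain ⟨y, hy⟩ := (key M le_rfl).exists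
  simpa using hy

theorem Op_subset_iterate (ξ : Ordinal.{v}) (a : 𝕜) (S : Set X) {M : ℕ} (hM : 1 ≤ M) :
    Op ξ a S ⊆ (Op ξ (a / M))^[M] S := by
  induction ξ using Ordinal.limitRecOn generalizing a S M with
  | zero => exact Op_zero_subset_iterate a S hM
  | add_one ξ ih =>
    intro z hz
    obtain ⟨N, hN, hz⟩ := mem_Op_succ.1 hz
    have h1 := (Op_mono (X := X) ξ (a / N)).iterate_le_of_le (fun S => ih (a / N) S hM) N S hz
    -- The `N` blocks of `M` games are regrouped into `M` blocks of `N` games, each block being a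
    -- strategy at level `ξ + 1` with coefficient `a / M`.
    rw [← Function.iterate_mul, mul_comm, Function.iterate_mul, div_right_comm] at h1
    refine (((Op_mono ξ (a / M / N)).iterate N).iterate_le_of_le (fun S z hz => ?_) M S) h1
    exact mem_Op_succ.2 ⟨N, hN, hz⟩
  | limit ξ hξ ih =>
    intro z hz
    obtain ⟨ζ, hζ, hz⟩ := (mem_Op_limit hξ).1 hz
    have h1 := ih (ζ + 1) (hξ.add_one_lt hζ) a S hM hz
    refine (Op_mono _ _).iterate_le_of_le (fun S z hz => ?_) M S h1
    exact (mem_Op_limit hξ).2 ⟨ζ, hζ, hz⟩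

theorem Op_subset_Op_of_le {ζ ξ : Ordinal.{v}} (h : ζ ≤ ξ) (a : 𝕜) (S : Set X) :
    Op ζ a S ⊆ Op ξ a S := by
  have hs : ∀ η : Ordinal.{v}, Op η a S ⊆ Op (η + 1) a S := fun η z hz =>
    mem_Op_succ.2 ⟨1, le_rfl, by simpa using hz⟩
  induction ξ using Ordinal.limitRecOn with
  | zero => rw [nonpos_iff_eq_zero.1 h]
  | add_one ξ ih =>
    rcases h.lt_or_eq with h | rfl
    · exact (ih (Order.lt_add_one_iff.1 h)).trans (hs ξ)
    · rfl
  | limit ξ hξ ih =>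
    rcases h.lt_or_eq with h | rfl
    · exact fun z hz => (mem_Op_limit hξ).2 ⟨ζ, h, hs ζ hz⟩
    · rfl

theorem inter_iterate_subset {ξ : Ordinal.{v}} {a : 𝕜}
    (h : ∀ S T : Set X, Op ξ a S ∩ Op ξ a T ⊆ Op ξ a (S ∩ T)) (n : ℕ) (S T : Set X) :
    (Op ξ a)^[n] S ∩ (Op ξ a)^[n] T ⊆ (Op ξ a)^[n] (S ∩ T) := by
  induction n with
  | zero => exact subset_rfl
  | succ n ih =>
    simp only [Function.iterate_succ_apply']
    exact (h _ _).trans (Op_mono ξ a ih)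

/-- If the first player can force the game into `S` and into `T`, he can force it into `S ∩ T`. -/
theorem Op_inter_subset (ξ : Ordinal.{v}) (a : 𝕜) (S T : Set X) :
    Op ξ a S ∩ Op ξ a T ⊆ Op ξ a (S ∩ T) := by
  induction ξ using Ordinal.limitRecOn generalizing a S T with
  | zero =>
    rintro z ⟨h1, h2⟩
    rw [mem_Op_zero] at h1 h2 ⊢
    exact h1.and h2
  | add_one ξ ih =>
    have hsplit : ∀ (S : Set X) (N M : ℕ), 1 ≤ M →
        (Op ξ (a / N))^[N] S ⊆ (Op ξ (a / (N * M : ℕ)))^[N * M] S := by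
      intro S N M hM
      have := (Op_mono (X := X) ξ (a / N)).iterate_le_of_le
        (fun S => Op_subset_iterate ξ (a / N) S hM) N S
      rw [← Function.iterate_mul, mul_comm, div_div] at this
      rw [Nat.cast_mul]
      exact this
    rintro z ⟨h1, h2⟩
    obtain ⟨N, hN, h1⟩ := mem_Op_succ.1 h1
    obtain ⟨M, hM, h2⟩ := mem_Op_succ.1 h2
    -- The product is a common refinement of the two numbers of games, where the induction
    -- hypothesis can be iterated.
    refine mem_Op_succ.2 ⟨N * M, Nat.mul_pos hN hM, ?_⟩
    refine inter_iterate_subset (ih _) _ S T ⟨hsplit S N M hM h1, ?_⟩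
    rw [mul_comm]
    exact hsplit T M N hN h2
  | limit ξ hξ ih =>
    rintro z ⟨h1, h2⟩
    obtain ⟨ζ, hζ, h1⟩ := (mem_Op_limit hξ).1 h1
    obtain ⟨η, hη, h2⟩ := (mem_Op_limit hξ).1 h2
    have hm : max ζ η < ξ := max_lt hζ hη
    refine (mem_Op_limit hξ).2 ⟨max ζ η, hm, ih _ (hξ.add_one_lt hm) a S T ⟨?_, ?_⟩⟩
    · exact Op_subset_Op_of_le (by gcongr; exact le_max_left _ _) a S h1
    · exact Op_subset_Op_of_le (by gcongr; exact le_max_right _ _) a T h2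

/-- This places two estimates on one and the same branch, which is what the triangle inequality
needs. -/
theorem Forces.inter {ξ : Ordinal.{v}} {n : ℕ} {a : ℕ → 𝕜} {S T : Set X} {z : X}
    (h₁ : Forces S (Gam ξ n) (coef ξ n a) z) (h₂ : Forces T (Gam ξ n) (coef ξ n a) z) :
    Forces (S ∩ T) (Gam ξ n) (coef ξ n a) z := by
  induction n generalizing a z with
  | zero =>
    rw [Gam_zero_right, forces_empty] at *
    exact ⟨h₁, h₂⟩
  | succ n ih =>
    rw [forces_coef_add_one] at *
    exact Op_mono _ _ (fun x hx => ih hx.1 hx.2) (Op_inter_subset _ _ _ _ ⟨h₁, h₂⟩)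

/-- If a seminorm is eventually at most `δ` along weakly null vectors, then a play on `Γ_{ξ,1}` can
increase it by at most `‖a‖ δ`. -/
theorem mem_Op_of_seminorm_le (g : Seminorm 𝕜 X) {δ : ℝ}
    (hg : ∀ᶠ y in nullFilter 𝕜 X, g y ≤ δ) (ξ : Ordinal.{v}) (a : 𝕜) {r : ℝ} {z : X}
    (hz : g z ≤ r) : z ∈ Op ξ a {x | g x ≤ r + ‖a‖ * δ} := by
  -- Since `Op` increases with the ordinal, it is enough to play a single round with coefficient
  -- `a`.
  refine Op_subset_Op_of_le (zero_le (a := ξ)) a _ (mem_Op_zero.2 ?_)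
  filter_upwards [hg] with y hy
  calc g (z + a • y) ≤ g z + g (a • y) := map_add_le_add g _ _
    _ = g z + ‖a‖ * g y := by rw [map_smul_eq_mul]
    _ ≤ r + ‖a‖ * δ := by gcongr

theorem forces_of_seminorm_le (g : Seminorm 𝕜 X) {δ : ℝ}
    (hg : ∀ᶠ y in nullFilter 𝕜 X, g y ≤ δ) (ξ : Ordinal.{v}) (n : ℕ) (a : ℕ → 𝕜) {r : ℝ} {z : X}
    (hz : g z ≤ r) :
    Forces {x | g x ≤ r + (∑ i ∈ Finset.range n, ‖a i‖) * δ} (Gam ξ n) (coef ξ n a) z := by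
  induction n generalizing a r z with
  | zero =>
    rw [Gam_zero_right, forces_empty]
    simpa using hz
  | succ n ih =>
    rw [forces_coef_add_one]
    refine Op_mono _ _ (fun x hx => ?_) (mem_Op_of_seminorm_le g hg ξ (a 0) hz)
    refine (ih (fun i => a (i + 1)) hx).mono fun y hy => ?_
    rw [Finset.sum_range_succ']
    simp only [Set.mem_ofPred_eq] at hy ⊢
    linarith

/-! ### The seminorms and the game -/

variable {Y : Type u} [NormedAddCommGroup Y] [NormedSpace 𝕜 Y]

theorem mem_maxNodes_treeProd {Λ D : Type*} [Nonempty D] {T : Set (List Λ)} {t : List (Λ × D)} :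
    t ∈ maxNodes (treeProd T D) ↔ t.map Prod.fst ∈ maxNodes T := by
  constructor
  · rintro ⟨h1, h2⟩
    refine ⟨h1, ?_⟩
    rintro _ hs ⟨r, rfl⟩
    obtain ⟨d⟩ := ‹Nonempty D›
    have := h2 (t ++ r.map fun ζ => (ζ, d))
      (by simpa [treeProd, Function.comp_def] using hs) ⟨_, rfl⟩
    simpa using this
  · rintro ⟨h1, h2⟩
    refine ⟨h1, ?_⟩
    rintro _ hs ⟨r, rfl⟩
    have := h2 _ hs (by simp)
    simpa using this

/-- The contribution of the collections on `Γ_{ξ,n}` to `‖·‖_{ξ,A}`. -/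
def value (ξ : Ordinal.{v}) (n : ℕ) (A : X →L[𝕜] Y) (a : ℕ →₀ 𝕜) : ℝ≥0∞ :=
  ⨆ x ∈ nullCollections 𝕜 ξ n X,
    ⨅ t ∈ maxNodes (treeProd (Gam ξ n) (WeakNhds 𝕜 X)), ‖A (branchSum ξ n a x t)‖ₑ

theorem seminormOf_eq (ξ : Ordinal.{v}) (A : X →L[𝕜] Y) (a : ℕ →₀ 𝕜) :
    seminormOf ξ A a = ⨆ n : ℕ, ⨆ _ : 1 ≤ n, value ξ n A a := rfl

/-- The collection `replies` is the witness: if the first player could not win, it would keep every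
maximal branch outside the target set. -/
theorem forces_of_value_lt {ξ : Ordinal.{v}} {n : ℕ} {A : X →L[𝕜] Y} {a : ℕ →₀ 𝕜} {c : ℝ≥0∞}
    (h : value ξ n A a < c) : Forces {x | ‖A x‖ₑ < c} (Gam ξ n) (coef ξ n a) 0 := by
  by_contra hn
  refine h.not_ge ?_
  set x := replies {x | ‖A x‖ₑ < c} (Gam ξ n) (coef ξ n a) 0
  refine le_iSup₂_of_le x ⟨isWeaklyNull_replies _ _ _ _ _, fun t _ => norm_replies_le _ _ _ _ t⟩ ?_
  refine le_iInf₂ fun t ht => ?_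
  have := pathSum_replies_notMem (prefixClosed_Gam ξ n) hn (mem_maxNodes_treeProd.1 ht)
  rw [zero_add, ← branchSum_eq_pathSum] at this
  simpa using this

theorem value_le_of_forces {ξ : Ordinal.{v}} {n : ℕ} (hn : 1 ≤ n) {A : X →L[𝕜] Y} {a : ℕ →₀ 𝕜}
    {c : ℝ≥0∞} (h : Forces {x | ‖A x‖ₑ ≤ c} (Gam ξ n) (coef ξ n a) 0) : value ξ n A a ≤ c := by
  refine iSup₂_le fun x hx => ?_
  obtain ⟨t, ht, h⟩ := h.exists_branch (Gam_nonempty ξ hn) hx.1 hx.2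
  rw [zero_add, ← branchSum_eq_pathSum] at h
  exact (iInf₂_le t (mem_maxNodes_treeProd.2 ht)).trans h

theorem value_add_le {ξ : Ordinal.{v}} {n : ℕ} (hn : 1 ≤ n) (A B : X →L[𝕜] Y) (a : ℕ →₀ 𝕜) :
    value ξ n (A + B) a ≤ value ξ n A a + value ξ n B a := by
  refine ENNReal.le_of_forall_pos_le_add fun ε hε hlt => ?_
  obtain ⟨hA, hB⟩ := ENNReal.add_lt_top.1 hlt
  have hε' : (ε / 2 : ℝ≥0∞) ≠ 0 := by simpa using hε.ne'
  have h1 := forces_of_value_lt (ENNReal.lt_add_right hA.ne hε')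
  have h2 := forces_of_value_lt (ENNReal.lt_add_right hB.ne hε')
  have h : value ξ n (A + B) a ≤ (value ξ n A a + ε / 2) + (value ξ n B a + ε / 2) := by
    refine value_le_of_forces hn ((h1.inter h2).mono ?_)
    rintro x ⟨hx1, hx2⟩
    exact (enorm_add_le _ _).trans (add_le_add hx1.le hx2.le)
  rwa [add_add_add_comm, ENNReal.add_halves] at h

theorem seminormOf_add_le (ξ : Ordinal.{v}) (A B : X →L[𝕜] Y) (a : ℕ →₀ 𝕜) :
    seminormOf ξ (A + B) a ≤ seminormOf ξ A a + seminormOf ξ B a := by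
  simp only [seminormOf_eq]
  refine iSup₂_le fun n hn => (value_add_le hn A B a).trans (add_le_add ?_ ?_)
  · exact le_iSup₂ (f := fun n (_ : 1 ≤ n) => value ξ n A a) n hn
  · exact le_iSup₂ (f := fun n (_ : 1 ≤ n) => value ξ n B a) n hn

/-- Only the `ℓ₁` norm of `a` enters, so the bound is uniform in `n`. It is used with arbitrarily
small `δ` for operators of rank one and with `δ = ‖A‖` in general. -/
theorem seminormOf_le_of_eventually (ξ : Ordinal.{v}) (A : X →L[𝕜] Y) (a : ℕ →₀ 𝕜) {δ : ℝ}
    (hδ : 0 ≤ δ) (hA : ∀ᶠ y in nullFilter 𝕜 X, ‖A y‖ ≤ δ) :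
    seminormOf ξ A a ≤ ENNReal.ofReal ((∑ i ∈ a.support, ‖a i‖) * δ) := by
  rw [seminormOf_eq]
  refine iSup₂_le fun n hn => value_le_of_forces hn ?_
  refine (forces_of_seminorm_le ((normSeminorm 𝕜 Y).comp (A : X →ₗ[𝕜] Y)) hA ξ n a (r := 0)
    (by simp)).mono fun x hx => ?_
  have hs : ∑ i ∈ Finset.range n, ‖a i‖ ≤ ∑ i ∈ a.support, ‖a i‖ := by
    rw [← Finset.sum_filter_ne_zero]
    refine Finset.sum_le_sum_of_subset_of_nonneg (fun i hi => ?_) fun i _ _ => norm_nonneg _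
    simpa using (Finset.mem_filter.1 hi).2
  have hx' : ‖A x‖ ≤ 0 + (∑ i ∈ Finset.range n, ‖a i‖) * δ := hx
  rw [Set.mem_ofPred_eq, ← ofReal_norm]
  refine ENNReal.ofReal_le_ofReal (hx'.trans ?_)
  rw [zero_add]
  gcongr

theorem seminormOf_zero (ξ : Ordinal.{v}) (a : ℕ →₀ 𝕜) :
    seminormOf ξ (0 : X →L[𝕜] Y) a = 0 := by
  simpa using seminormOf_le_of_eventually ξ (0 : X →L[𝕜] Y) a le_rfl (by simp)

theorem seminormOf_le_mul {Z : Type u} [NormedAddCommGroup Z] [NormedSpace 𝕜 Z] (ξ : Ordinal.{v})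
    {A : X →L[𝕜] Y} {B : X →L[𝕜] Z} {c : ℝ≥0∞} (hc : c ≠ ∞) (h : ∀ x, ‖B x‖ₑ ≤ c * ‖A x‖ₑ)
    (a : ℕ →₀ 𝕜) : seminormOf ξ B a ≤ c * seminormOf ξ A a := by
  -- Multiplication by `0` does not commute with empty infima, whose value is `∞`.
  by_cases hc0 : c = 0
  · obtain rfl : B = 0 := by
      ext x
      simpa [hc0] using h x
    simp [seminormOf_zero]
  simp only [seminormOf, ENNReal.mul_iSup, ENNReal.mul_iInf_of_ne hc0 hc]
  gcongr
  exact h _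

theorem seminormOf_comp_le {W : Type u} [NormedAddCommGroup W] [NormedSpace 𝕜 W] (ξ : Ordinal.{v})
    (A : X →L[𝕜] Y) (C : W →L[𝕜] X) (hC : ‖C‖ ≤ 1) (a : ℕ →₀ 𝕜) :
    seminormOf ξ (A ∘L C) a ≤ seminormOf ξ A a := by
  simp only [seminormOf_eq]
  gcongr with n hn
  refine le_of_forall_gt fun c hc => ?_
  obtain ⟨d, hd, hdc⟩ := exists_between hc
  refine (value_le_of_forces hn ?_).trans_lt hdc
  have h := forces_of_value_lt hd
  rw [← map_zero C] at h
  exact (h.of_map C hC).mono fun x (hx : ‖A (C x)‖ₑ < d) => hx.le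

theorem seminormOf_comp_comp_le {W Z : Type u} [NormedAddCommGroup W] [NormedSpace 𝕜 W]
    [NormedAddCommGroup Z] [NormedSpace 𝕜 Z] (ξ : Ordinal.{v})
    (C : W →L[𝕜] X) (A : X →L[𝕜] Y) (B : Y →L[𝕜] Z) (a : ℕ →₀ 𝕜) :
    seminormOf ξ (B ∘L A ∘L C) a ≤ ‖B‖ₑ * ‖C‖ₑ * seminormOf ξ A a := by
  -- For `C = 0` the inverse is `0` by convention, and `C = ‖C‖ • C'` still holds.
  set C' : W →L[𝕜] X := ((‖C‖⁻¹ : ℝ) : 𝕜) • C with hC'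
  have hn : ‖C'‖ ≤ 1 := by
    rw [hC', norm_smul, RCLike.norm_ofReal, abs_of_nonneg (by positivity)]
    exact inv_mul_le_one
  refine (seminormOf_le_mul ξ (A := A ∘L C') (c := ‖B‖ₑ * ‖C‖ₑ)
    (ENNReal.mul_ne_top enorm_ne_top enorm_ne_top) (fun x => ?_) a).trans ?_
  · have hx : C x = ((‖C‖ : ℝ) : 𝕜) • C' x := by
      by_cases h0 : C = 0
      · simp [h0]
      · have : (‖C‖ : 𝕜) ≠ 0 := by exact_mod_cast norm_ne_zero_iff.2 h0
        simp [hC', smul_smul, this]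
    have he : ‖((‖C‖ : ℝ) : 𝕜)‖ₑ = ‖C‖ₑ := by
      rw [← ofReal_norm, ← ofReal_norm, RCLike.norm_ofReal, abs_norm]
    calc ‖B (A (C x))‖ₑ ≤ ‖B‖ₑ * ‖A (C x)‖ₑ := B.le_opENorm _
      _ = ‖B‖ₑ * ‖C‖ₑ * ‖A (C' x)‖ₑ := by rw [hx, map_smul, enorm_smul, he, mul_assoc]
  · gcongr
    exact seminormOf_comp_le ξ A C' hn a

/-! ### The quantities `N_{ξ,p}` -/

theorem supN_le_mul {W Z : Type u} [NormedAddCommGroup W] [NormedSpace 𝕜 W]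
    [NormedAddCommGroup Z] [NormedSpace 𝕜 Z] {ξ : Ordinal.{v}} (p : ℝ≥0∞) {A : X →L[𝕜] Y}
    {B : W →L[𝕜] Z} {c : ℝ≥0∞}
    (h : ∀ a : ℕ →₀ 𝕜, seminormOf ξ B a ≤ c * seminormOf ξ A a) :
    supN ξ p B ≤ c * supN ξ p A := by
  simp only [supN, ENNReal.mul_iSup]
  refine iSup₂_mono fun n hn => ?_
  rw [mul_left_comm]
  gcongr
  exact h _

theorem le_supN {ξ : Ordinal.{v}} {p : ℝ≥0∞} {n : ℕ} (hn : 1 ≤ n) (A : X →L[𝕜] Y) :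
    (n : ℝ≥0∞) ^ (p.conjExponent⁻¹).toReal * theta ξ n A ≤ supN ξ p A :=
  le_iSup₂ (f := fun (n : ℕ) (_ : 1 ≤ n) =>
    (n : ℝ≥0∞) ^ (p.conjExponent⁻¹).toReal * theta ξ n A) n hn

theorem supN_add_le (ξ : Ordinal.{v}) (p : ℝ≥0∞) (A B : X →L[𝕜] Y) :
    supN ξ p (A + B) ≤ supN ξ p A + supN ξ p B := by
  refine iSup₂_le fun n hn => ?_
  calc _ ≤ (n : ℝ≥0∞) ^ (p.conjExponent⁻¹).toReal * (theta ξ n A + theta ξ n B) := by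
        gcongr; exact seminormOf_add_le ξ A B _
    _ ≤ _ := by rw [mul_add]; exact add_le_add (le_supN hn A) (le_supN hn B)

theorem supN_smul_le (ξ : Ordinal.{v}) (p : ℝ≥0∞) (c : 𝕜) (A : X →L[𝕜] Y) :
    supN ξ p (c • A) ≤ ‖c‖ₑ * supN ξ p A :=
  supN_le_mul p fun a => seminormOf_le_mul ξ enorm_ne_top (fun x => by simp [enorm_smul]) a

theorem supN_smul (ξ : Ordinal.{v}) (p : ℝ≥0∞) (c : 𝕜) (A : X →L[𝕜] Y) :
    supN ξ p (c • A) = ‖c‖ₑ * supN ξ p A := by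
  refine (supN_smul_le ξ p c A).antisymm ?_
  by_cases hc : c = 0
  · simp [hc]
  have h0 : ‖c‖ₑ ≠ 0 := by simpa using hc
  -- The reverse inequality is the upper bound applied to `c⁻¹` and `c • A`.
  calc ‖c‖ₑ * supN ξ p A = ‖c‖ₑ * supN ξ p (c⁻¹ • c • A) := by rw [inv_smul_smul₀ hc]
    _ ≤ ‖c‖ₑ * (‖c⁻¹‖ₑ * supN ξ p (c • A)) := by gcongr; exact supN_smul_le ξ p _ _
    _ = supN ξ p (c • A) := by
      rw [enorm_inv hc, ← mul_assoc, ENNReal.mul_inv_cancel h0 enorm_ne_top, one_mul]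

theorem seminormOf_smulRight (ξ : Ordinal.{v}) (f : StrongDual 𝕜 X) (y : Y) (a : ℕ →₀ 𝕜) :
    seminormOf ξ (f.smulRight y) a = 0 := by
  have ht : Filter.Tendsto (fun δ : ℝ => ENNReal.ofReal ((∑ i ∈ a.support, ‖a i‖) * δ)) (𝓝[>] 0)
      (𝓝 0) := by
    have : Continuous fun δ : ℝ => ENNReal.ofReal ((∑ i ∈ a.support, ‖a i‖) * δ) :=
      ENNReal.continuous_ofReal.comp (continuous_const_mul _)
    simpa using (this.tendsto 0).mono_left nhdsWithin_le_nhds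
  refine le_antisymm (ge_of_tendsto ht ?_) (zero_le)
  filter_upwards [self_mem_nhdsWithin] with δ hδ
  refine seminormOf_le_of_eventually ξ _ a (le_of_lt hδ) ?_
  have h := ((tendsto_apply_nullFilter f).smul_const y).norm
  rw [zero_smul, norm_zero] at h
  exact h.eventually_le_const hδ

theorem supN_smulRight (ξ : Ordinal.{v}) (p : ℝ≥0∞) (f : StrongDual 𝕜 X) (y : Y) :
    supN ξ p (f.smulRight y) = 0 := by
  simp [supN, theta, seminormOf_smulRight]

theorem seminormOf_le_opNorm (ξ : Ordinal.{v}) (A : X →L[𝕜] Y) (a : ℕ →₀ 𝕜) :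
    seminormOf ξ A a ≤ ENNReal.ofReal ((∑ i ∈ a.support, ‖a i‖) * ‖A‖) := by
  refine seminormOf_le_of_eventually ξ A a (norm_nonneg A) ?_
  filter_upwards [eventually_norm_le_one (𝕜 := 𝕜)] with y hy
  exact (A.le_opNorm y).trans (mul_le_of_le_one_right (norm_nonneg A) hy)

/-- Lower semicontinuity of `N_{ξ,p}` with respect to the operator norm. -/
theorem supN_sub_le_of_tendsto {ξ : Ordinal.{v}} {p : ℝ≥0∞} {A : ℕ → X →L[𝕜] Y} {B C : X →L[𝕜] Y}
    {c : ℝ≥0∞} (hA : Filter.Tendsto A Filter.atTop (𝓝 B))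
    (h : ∀ᶠ m in Filter.atTop, supN ξ p (C - A m) ≤ c) : supN ξ p (C - B) ≤ c := by
  refine iSup₂_le fun n hn => ?_
  set k : ℝ≥0∞ := (n : ℝ≥0∞) ^ (p.conjExponent⁻¹).toReal with hk
  have hk' : k ≠ ∞ := ENNReal.rpow_ne_top_of_nonneg ENNReal.toReal_nonneg (by simp)
  set a : ℕ →₀ 𝕜 := (n : 𝕜)⁻¹ • ∑ i ∈ Finset.range n, Finsupp.single i 1
  -- For fixed `n` the passage from `A m` to `B` costs a constant times `‖A m - B‖`, which tends to
  -- zero; the constant may depend on `n`.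
  have ht : Filter.Tendsto
      (fun m => c + k * ENNReal.ofReal ((∑ i ∈ a.support, ‖a i‖) * ‖A m - B‖))
      Filter.atTop (𝓝 c) := by
    have h1 : Filter.Tendsto (fun m => ‖A m - B‖) Filter.atTop (𝓝 0) :=
      tendsto_iff_norm_sub_tendsto_zero.1 hA
    have h2 := (ENNReal.tendsto_ofReal (h1.const_mul (∑ i ∈ a.support, ‖a i‖)))
    have h3 := ENNReal.Tendsto.const_mul h2 (Or.inr hk')
    simpa using h3.const_add c
  refine ge_of_tendsto ht ?_
  filter_upwards [h] with m hm
  calc k * theta ξ n (C - B) = k * seminormOf ξ ((C - A m) + (A m - B)) a := by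
        rw [sub_add_sub_cancel]; rfl
    _ ≤ k * (theta ξ n (C - A m) + seminormOf ξ (A m - B) a) := by
        gcongr; exact seminormOf_add_le ξ _ _ a
    _ ≤ _ := by
        rw [mul_add]
        gcongr
        · exact (le_supN hn _).trans hm
        · exact seminormOf_le_opNorm ξ _ a

/-! ### The ideal norm and completeness. -/

theorem norm_le_normN (ξ : Ordinal.{v}) (p : ℝ≥0∞) (A : X →L[𝕜] Y) : ‖A‖ ≤ normN ξ p A :=
  le_add_of_nonneg_right ENNReal.toReal_nonneg

theorem add_mem_classN {ξ : Ordinal.{v}} {p : ℝ≥0∞} {A B : X →L[𝕜] Y}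
    (hA : A ∈ classN 𝕜 ξ p X Y) (hB : B ∈ classN 𝕜 ξ p X Y) : A + B ∈ classN 𝕜 ξ p X Y :=
  (supN_add_le ξ p A B).trans_lt (ENNReal.add_lt_top.2 ⟨hA, hB⟩)

theorem smul_mem_classN {ξ : Ordinal.{v}} {p : ℝ≥0∞} (c : 𝕜) {A : X →L[𝕜] Y}
    (hA : A ∈ classN 𝕜 ξ p X Y) : c • A ∈ classN 𝕜 ξ p X Y :=
  (supN_smul_le ξ p c A).trans_lt (ENNReal.mul_lt_top enorm_lt_top hA)

theorem sub_mem_classN {ξ : Ordinal.{v}} {p : ℝ≥0∞} {A B : X →L[𝕜] Y}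
    (hA : A ∈ classN 𝕜 ξ p X Y) (hB : B ∈ classN 𝕜 ξ p X Y) : A - B ∈ classN 𝕜 ξ p X Y := by
  rw [sub_eq_add_neg, ← neg_one_smul 𝕜 B]
  exact add_mem_classN hA (smul_mem_classN _ hB)

theorem supN_comp_comp_le {W Z : Type u} [NormedAddCommGroup W] [NormedSpace 𝕜 W]
    [NormedAddCommGroup Z] [NormedSpace 𝕜 Z] (ξ : Ordinal.{v}) (p : ℝ≥0∞)
    (C : W →L[𝕜] X) (A : X →L[𝕜] Y) (B : Y →L[𝕜] Z) :
    supN ξ p (B ∘L A ∘L C) ≤ ‖B‖ₑ * ‖C‖ₑ * supN ξ p A :=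
  supN_le_mul p fun a => seminormOf_comp_comp_le ξ C A B a

theorem normN_comp_comp_le {W Z : Type u} [NormedAddCommGroup W] [NormedSpace 𝕜 W]
    [NormedAddCommGroup Z] [NormedSpace 𝕜 Z] {ξ : Ordinal.{v}} {p : ℝ≥0∞}
    (C : W →L[𝕜] X) {A : X →L[𝕜] Y} (B : Y →L[𝕜] Z) (hA : A ∈ classN 𝕜 ξ p X Y) :
    normN ξ p (B ∘L A ∘L C) ≤ ‖B‖ * normN ξ p A * ‖C‖ := by
  have h1 : ‖B ∘L A ∘L C‖ ≤ ‖B‖ * (‖A‖ * ‖C‖) :=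
    (B.opNorm_comp_le _).trans (by gcongr; exact A.opNorm_comp_le C)
  have h2 : (supN ξ p (B ∘L A ∘L C)).toReal ≤ ‖B‖ * ‖C‖ * (supN ξ p A).toReal := by
    have := ENNReal.toReal_mono
      (ENNReal.mul_ne_top (ENNReal.mul_ne_top enorm_ne_top enorm_ne_top) (ne_of_lt hA))
      (supN_comp_comp_le ξ p C A B)
    simpa [ENNReal.toReal_mul] using this
  rw [normN, normN]
  linarith

/-- The limit is taken in the operator norm, which is dominated by `normN`. Lower semicontinuity
then carries the Cauchy estimate for `supN` over to the differences `A n - B`. -/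
theorem exists_limit_classN [CompleteSpace Y] {ξ : Ordinal.{v}} {p : ℝ≥0∞} (A : ℕ → X →L[𝕜] Y)
    (hA : ∀ n, A n ∈ classN 𝕜 ξ p X Y)
    (hc : ∀ ε : ℝ, 0 < ε → ∃ N, ∀ m ≥ N, ∀ n ≥ N, normN ξ p (A m - A n) < ε) :
    ∃ B ∈ classN 𝕜 ξ p X Y,
      Filter.Tendsto (fun n => normN ξ p (A n - B)) Filter.atTop (𝓝 0) := by
  have hcau : CauchySeq A := by
    refine Metric.cauchySeq_iff.2 fun ε hε => ?_
    obtain ⟨N, hN⟩ := hc ε hε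
    refine ⟨N, fun m hm n hn => ?_⟩
    rw [dist_eq_norm]
    exact (norm_le_normN ξ p _).trans_lt (hN m hm n hn)
  obtain ⟨B, hB⟩ := cauchySeq_tendsto_of_complete hcau
  have hsup : ∀ ε : ℝ, 0 < ε → ∃ N, ∀ n ≥ N, supN ξ p (A n - B) ≤ ENNReal.ofReal ε := by
    intro ε hε
    obtain ⟨N, hN⟩ := hc ε hε
    refine ⟨N, fun n hn => supN_sub_le_of_tendsto hB ?_⟩
    filter_upwards [Filter.eventually_ge_atTop N] with m hm
    refine (ENNReal.le_ofReal_iff_toReal_le (ne_of_lt (sub_mem_classN (hA n) (hA m))) hε.le).2 ?_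
    have h1 := hN n hn m hm
    have h2 := norm_nonneg (A n - A m)
    rw [normN] at h1
    linarith
  refine ⟨B, ?_, ?_⟩
  · obtain ⟨N, hN⟩ := hsup 1 one_pos
    have h1 : A N - B ∈ classN 𝕜 ξ p X Y := (hN N le_rfl).trans_lt ENNReal.ofReal_lt_top
    simpa using sub_mem_classN (hA N) h1
  · have h1 : Filter.Tendsto (fun n => ‖A n - B‖) Filter.atTop (𝓝 0) :=
      tendsto_iff_norm_sub_tendsto_zero.1 hB
    have h2 : Filter.Tendsto (fun n => (supN ξ p (A n - B)).toReal) Filter.atTop (𝓝 0) := by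
      refine Metric.tendsto_atTop.2 fun ε hε => ?_
      obtain ⟨N, hN⟩ := hsup (ε / 2) (by positivity)
      refine ⟨N, fun n hn => ?_⟩
      rw [Real.dist_eq, sub_zero, abs_of_nonneg ENNReal.toReal_nonneg]
      exact (ENNReal.toReal_le_of_le_ofReal (by positivity) (hN n hn)).trans_lt (by linarith)
    simpa [normN] using h1.add h2

end Operators

end SzlenkIdeal

end

theorem mainTheorem8 (𝕜 : Type w) [RCLike 𝕜] (ξ : Ordinal.{v}) (p : ℝ≥0∞) (hp : 1 < p) :
    SzlenkIdeal.IsBanachIdeal.{u, w}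
      (fun X Y _ _ _ _ _ _ => SzlenkIdeal.classN 𝕜 ξ p X Y)
      (fun X Y _ _ _ _ _ _ => SzlenkIdeal.normN (𝕜 := 𝕜) (X := X) (Y := Y) ξ p) := by
  refine ⟨⟨?_, ?_, ?_, ?_⟩, ⟨?_, ?_, ?_, ?_, ?_, ?_⟩, ?_⟩
  · intro X Y _ _ _ _ _ _ f y
    change SzlenkIdeal.supN ξ p _ < ∞
    simp [SzlenkIdeal.supN_smulRight]
  · intro X Y _ _ _ _ _ _ A B hA hB
    exact SzlenkIdeal.add_mem_classN hA hB
  · intro X Y _ _ _ _ _ _ c A hA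
    exact SzlenkIdeal.smul_mem_classN c hA
  · intro W X Y Z _ _ _ _ _ _ _ _ _ _ _ _ C A B hA
    exact (SzlenkIdeal.supN_comp_comp_le ξ p C A B).trans_lt
      (ENNReal.mul_lt_top (ENNReal.mul_lt_top enorm_lt_top enorm_lt_top) hA)
  · intro X Y _ _ _ _ _ _ A _
    exact (norm_nonneg A).trans (SzlenkIdeal.norm_le_normN ξ p A)
  · intro X Y _ _ _ _ _ _ A _
    constructor
    · intro h
      exact norm_le_zero_iff.1 ((SzlenkIdeal.norm_le_normN ξ p A).trans h.le)
    · rintro rfl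
      simp [SzlenkIdeal.normN, SzlenkIdeal.supN, SzlenkIdeal.theta, SzlenkIdeal.seminormOf_zero]
  · intro X Y _ _ _ _ _ _ A B hA hB
    have h1 := norm_add_le A B
    have h2 := ENNReal.toReal_mono (ENNReal.add_lt_top.2 ⟨hA, hB⟩).ne
      (SzlenkIdeal.supN_add_le ξ p A B)
    rw [ENNReal.toReal_add (ne_of_lt hA) (ne_of_lt hB)] at h2
    simp only [SzlenkIdeal.normN]
    linarith
  · intro X Y _ _ _ _ _ _ c A _
    simp [SzlenkIdeal.normN, SzlenkIdeal.supN_smul, ENNReal.toReal_mul, norm_smul, mul_add]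
  · intro X Y _ _ _ _ _ _ f y
    simp [SzlenkIdeal.normN, SzlenkIdeal.supN_smulRight]
  · intro W X Y Z _ _ _ _ _ _ _ _ _ _ _ _ C A B hA
    exact SzlenkIdeal.normN_comp_comp_le C B hA
  · intro X Y _ _ _ _ _ _ A hA hc
    exact SzlenkIdeal.exists_limit_classN A hA hc
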